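/- Let $r\neq s$ be positive integers. Let $T_{2,1}$ be the bicoloured plane tree with $n=2r+2s$ edges whose black vertices have degrees $r,r,s,s$, whose white vertices have degrees $4,1,\dots,1$, and for which the degrees of the black vertices, read cyclically around the white vertex of degree $4$, are $r,s,r,s$. Let $\sigma_0$ (resp. $\sigma_1$) be the permutation of the edges sending each edge to the next one around its black (resp. white) endpoint, and let $G=\langle\sigma_0,\sigma_1\rangle$ be the monodromy group of $T_{2,1}$. Put $d=\gcd(r,s)$, $r=r_1d$, $s=s_1d$ and $m=r_1+s_1$. Then $$G\cong\begin{cases} S_4^{\,d}\rtimes\mathbb Z_{2d} & \text{if } (r_1,s_1)=(1,2),\\ (Q_8\rtimes S_4)^d\rtimes\mathbb Z_d & \text{if } (r_1,s_1)=(1,3),\\ \big((\mathbb Z_2^{m-1}\rtimes A_m)\rtimes\mathbb Z_2\big)^d\rtimes\mathbb Z_d & \text{if } m \text{ is even and } (r_1,s_1)\neq(1,3),\\ (\mathbb Z_2^{m-1}\rtimes S_m)^d\rtimes\mathbb Z_{2d} & \text{if } m \text{ is odd and } (r_1,s_1)\neq(1,2). \end{cases}$$ Here the outer cyclic group $\mathbb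 Z_d$ or $\mathbb Z_{2d}$ acts by cyclically permuting the $d$ factors, a generator acting as the cyclic shift by one (so $\mathbb Z_{2d}$ acts through its quotient $\mathbb Z_d$); $Q_8$ is the quaternion group of order $8$, on which $S_4$ acts by some faithful action by automorphisms; $\mathbb Z_2^{m-1}$ is realised as the group of vectors in $\mathbb Z_2^m$ with zero coordinate sum, on which $S_m$ and $A_m$ act by permuting the coordinates; and in the third case $\mathbb Z_2$ acts on $\mathbb Z_2^{m-1}\rtimes A_m$ by some action by automorphisms. -/

import Mathlib

/-- A bicoloured plane tree with edge set `E`, encoded by its rotation system: `σ₀` (resp. `σ₁`)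
sends each edge to the next one in the cyclic order around its black (resp. white) endpoint.
Black (resp. white) vertices are the cycles of `σ₀` (resp. `σ₁`), fixed points included, and the
degree of a vertex is the length of its cycle. The map is a tree when it is connected
and has one more vertex than it has edges. -/
structure BicolouredPlaneTree (E : Type*) [Fintype E] [DecidableEq E] where
  σ₀ : Equiv.Perm E
  σ₁ : Equiv.Perm E
  connected : ∀ x y : E, ∃ g ∈ Subgroup.closure {σ₀, σ₁}, g x = y
  euler : σ₀.partition.parts.card + σ₁.partition.parts.card = Fintype.card E + 1

namespace BicolouredPlaneTree

variable {E : Type*} [Fintype E] [DecidableEq E]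

/-- The monodromy (cartographic) group of the tree, as a group of permutations of its edges. -/
def monodromyGroup (T : BicolouredPlaneTree E) : Subgroup (Equiv.Perm E) :=
  Subgroup.closure {T.σ₀, T.σ₁}

/-- The degree of the black endpoint of the edge `e` (the length of the `σ₀`-cycle of `e`). -/
noncomputable def blackDegree (T : BicolouredPlaneTree E) (e : E) : ℕ :=
  Function.minimalPeriod T.σ₀ e

/-- The tree has passport `[α; β; n]`: it has `n` edges, the partition `α` of `n` records the
degrees of the black vertices, and `β` those of the white vertices. -/
def HasPassport (T : BicolouredPlaneTree E) (α β : Multiset ℕ) (n : ℕ) : Prop :=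
  T.σ₀.partition.parts = α ∧ T.σ₁.partition.parts = β ∧ Fintype.card E = n

/-- `T` is the tree `T_{2,1}` with parameters `r, s`: its passport is
`[r², s²; 4, 1^{n-4}; n]` with `n = 2r + 2s`, and the degrees of the black vertices, read
cyclically around the white vertex of degree `4`, are `r, s, r, s`. -/
def IsT21 (T : BicolouredPlaneTree E) (r s : ℕ) : Prop :=
  T.HasPassport {r, r, s, s} (4 ::ₘ Multiset.replicate (2 * r + 2 * s - 4) 1) (2 * r + 2 * s) ∧
  ∃ e : E, Function.minimalPeriod T.σ₁ e = 4 ∧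
    T.blackDegree e = r ∧
    T.blackDegree (T.σ₁ e) = s ∧
    T.blackDegree (T.σ₁ (T.σ₁ e)) = r ∧
    T.blackDegree (T.σ₁ (T.σ₁ (T.σ₁ e))) = s

end BicolouredPlaneTree

/-- The cyclic group `ℤ/k`, written multiplicatively. -/
abbrev CyclicGroup (k : ℕ) : Type := Multiplicative (ZMod k)

/-- The vectors of even weight in `(ℤ/2)^m` (those whose coordinates have trivial sum). -/
def EvenVec (m : ℕ) : Subgroup (Fin m → CyclicGroup 2) where
  carrier := {v | ∏ i, v i = 1}
  one_mem' := by simp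
  mul_mem' := by
    intro a b ha hb
    simp only [Set.mem_ofPred_eq] at ha hb ⊢
    simp [Finset.prod_mul_distrib, ha, hb]
  inv_mem' := by
    intro a ha
    simp only [Set.mem_ofPred_eq] at ha ⊢
    simp [ha]

/-- `EvenVec m` is a copy of `(ℤ/2)^(m-1)`. -/
theorem EvenVec.nonempty_mulEquiv (m : ℕ) :
    Nonempty (EvenVec m ≃* (Fin (m - 1) → CyclicGroup 2)) := by
  have key : ∀ x : CyclicGroup 2, x * x = 1 := by decide
  cases m with
  | zero =>
    have : Subsingleton (EvenVec 0) := ⟨fun a b => Subtype.ext (funext fun i => i.elim0)⟩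
    exact ⟨{ toFun := fun _ => 1, invFun := fun _ => 1
             left_inv := fun _ => Subsingleton.elim _ _
             right_inv := fun _ => funext fun i => i.elim0
             map_mul' := fun _ _ => by simp }⟩
  | succ k =>
    refine ⟨{ toFun := fun v i => v.1 (Fin.succ i)
              invFun := fun w => ⟨Fin.cons (∏ i, w i) w, ?_⟩
              left_inv := ?_, right_inv := ?_, map_mul' := ?_ }⟩
    · change ∏ i, (Fin.cons (∏ i, w i) w : Fin (k + 1) → CyclicGroup 2) i = 1
      rw [Fin.prod_univ_succ]
      simpa using key _
    · rintro ⟨v, hv⟩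
      change ∏ i, v i = 1 at hv
      rw [Fin.prod_univ_succ] at hv
      apply Subtype.ext
      funext i
      refine Fin.cases ?_ (fun j => ?_) i
      · change ∏ i : Fin k, v i.succ = v 0
        exact mul_left_cancel (hv.trans (key (v 0)).symm)
      · rfl
    · intro w
      rfl
    · intro a b
      rfl

/-- The symmetric group `S_m` acting on `EvenVec m` by permuting coordinates:
`(π • v) i = v (π⁻¹ i)`. -/
def permAction (m : ℕ) : Equiv.Perm (Fin m) →* MulAut (EvenVec m) where
  toFun π :=
    { toFun := fun v => ⟨fun i => v.1 (π⁻¹ i), by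
        have h : ∏ i, v.1 i = 1 := v.2
        exact (Equiv.prod_comp π⁻¹ v.1).trans h⟩
      invFun := fun v => ⟨fun i => v.1 (π i), by
        have h : ∏ i, v.1 i = 1 := v.2
        exact (Equiv.prod_comp π v.1).trans h⟩
      left_inv := fun v => by ext i; simp
      right_inv := fun v => by ext i; simp
      map_mul' := fun _ _ => rfl }
  map_one' := by ext; rfl
  map_mul' := fun _ _ => by ext; simp [MulAut.mul_apply]

/-- The restriction of `permAction` to the alternating group `A_m`. -/
def altAction (m : ℕ) : alternatingGroup (Fin m) →* MulAut (EvenVec m) :=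
  (permAction m).comp (alternatingGroup (Fin m)).subtype

/-- For `d ∣ k`, the cyclic group `ℤ/k` acting on `H^d` (the direct product of `d` copies of `H`,
indexed by `ℤ/d`) by cyclically permuting the factors: `(a • f) i = f (i - a)`,
with `a` reduced modulo `d`. -/
def cyclicShift (H : Type*) [Group H] {d k : ℕ} (h : d ∣ k) :
    CyclicGroup k →* MulAut (ZMod d → H) where
  toFun a :=
    { toFun := fun f i => f (i - ZMod.castHom h (ZMod d) a.toAdd)
      invFun := fun f i => f (i + ZMod.castHom h (ZMod d) a.toAdd)
      left_inv := fun f => by funext i; simp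
      right_inv := fun f => by funext i; simp
      map_mul' := fun _ _ => rfl }
  map_one' := by
    ext f i
    change f (i - ZMod.castHom h (ZMod d) 0) = f i
    rw [map_zero, sub_zero]
  map_mul' := fun a b => by
    ext f i
    change f (i - ZMod.castHom h (ZMod d) (a.toAdd + b.toAdd)) =
      f (i - ZMod.castHom h (ZMod d) a.toAdd - ZMod.castHom h (ZMod d) b.toAdd)
    rw [map_add, sub_sub]

/-- The group `H^d ⋊ ℤ/k`, for `d ∣ k`, where `ℤ/k` cyclically permutes the `d` factors. -/
abbrev CyclicWreath (H : Type*) [Group H] {d k : ℕ} (h : d ∣ k) : Type _ :=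
  (ZMod d → H) ⋊[cyclicShift H h] CyclicGroup k

/-! Let e₀, e₁, e₂, e₃ be the edges around the white vertex of degree 4. By connectedness every edge
is σ₀^n e_k for some n and k. Writing n = i + d·j with 0 ≤ i < d splits the edges into d fibres.
Each fibre is the set of signed points ±x, where x runs over the disjoint union of a cycle of length
r₁ and one of length s₁, and e₀, e₂ (likewise e₁, e₃) differ only in sign. In these labels
(`exists_labelling`) σ₀ moves each fibre to the next and applies, on entering fibre 0, the
permutation c with cycles of lengths r₁ and s₁. Meanwhile σ₁ is a quarter turn x → y → -x → -y in
fibre 0.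

Since σ₀^d is c on every fibre, G contains the conjugates of the quarter turn by powers of c,
supported on fibre 0. As r₁ and s₁ are coprime, these generate the group R of all signed permutation
matrices of determinant 1 (`rotation_le_of_conj_signedSwap_mem`). Now det c = (-1)^m. If m is even,
c lies in R and can be divided off, leaving a pure shift of order d. If m is odd, c lies in -R and
there remains a shift twisted by the central element -1, of order 2d, whose powers meet R^d
trivially. So G is R^d ⋊ ℤ_d or R^d ⋊ ℤ_{2d} (`closure_wrapShift_mulEquiv`).

It remains to describe R. For m odd, scaling permutation matrices by their signs splits R over the
even sign changes; for m = 3 this gives S₄ as the affine group of 𝔽₂². For m even, R contains the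
rotations with even permutation with index 2, and an involution splits it. For m = 4, R is also the
holomorph of Q₈: left multiplications, complemented by the stabiliser of 1, which is the rotation
group in dimension 3. -/

/-! ### Wrapped shifts and cyclic wreath products -/

section Wreath

variable {d : ℕ} {Y : Type*}

/-- A family of permutations of `Y`, acting fibrewise on `ZMod d × Y`. -/
def fiberPerm (d : ℕ) (Y : Type*) : (ZMod d → Equiv.Perm Y) →* Equiv.Perm (ZMod d × Y) where
  toFun f :=
    { toFun := fun p => (p.1, f p.1 p.2)
      invFun := fun p => (p.1, (f p.1)⁻¹ p.2)
      left_inv := fun p => by simp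
      right_inv := fun p => by simp }
  map_one' := by ext <;> rfl
  map_mul' _ _ := by ext <;> rfl

@[simp] theorem fiberPerm_apply (f : ZMod d → Equiv.Perm Y) (p : ZMod d × Y) :
    fiberPerm d Y f p = (p.1, f p.1 p.2) := rfl

theorem fiberPerm_injective : Function.Injective (fiberPerm d Y) := by
  intro f g h
  funext i
  ext y
  have := congrArg (fun σ => (σ (i, y)).2) h
  simpa using this

/-- The permutation of `ZMod d × Y` moving each fibre to the next one, identically except that
`z` is applied on entering the fibre over `0`. -/
def wrapShift (d : ℕ) (z : Equiv.Perm Y) : Equiv.Perm (ZMod d × Y) where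
  toFun p := (p.1 + 1, if p.1 + 1 = 0 then z p.2 else p.2)
  invFun p := (p.1 - 1, if p.1 = 0 then z⁻¹ p.2 else p.2)
  left_inv p := by
    rcases p with ⟨i, y⟩
    by_cases h : i + 1 = 0
    · simp only [h, if_true, ← Equiv.Perm.mul_apply, inv_mul_cancel, Equiv.Perm.one_apply]
      simp only [← h, add_sub_cancel_right]
    · simp [h]
  right_inv p := by
    rcases p with ⟨i, y⟩
    by_cases h : i = 0 <;> simp [h]

theorem wrapShift_apply (z : Equiv.Perm Y) (p : ZMod d × Y) :
    wrapShift d z p = (p.1 + 1, if p.1 + 1 = 0 then z p.2 else p.2) := rfl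

theorem wrapShift_eq_mul (w z : Equiv.Perm Y) :
    wrapShift d (w * z) = fiberPerm d Y (Pi.mulSingle 0 w) * wrapShift d z := by
  ext p
  · rfl
  · rcases p with ⟨i, y⟩
    by_cases h : i + 1 = 0 <;> simp [wrapShift_apply, h]

/-- Starting in fibre 0, the walk re-enters fibre 0 once every `d` steps, so `z` has been applied `n
/ d` times. -/
theorem wrapShift_pow_zero (z : Equiv.Perm Y) (n : ℕ) (y : Y) :
    (wrapShift d z ^ n) (0, y) = ((n : ZMod d), (z ^ (n / d)) y) := by
  induction n with
  | zero => simp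
  | succ n ih =>
    rw [pow_succ', Equiv.Perm.mul_apply, ih, wrapShift_apply]
    have h : ((n : ZMod d) + 1 = 0) ↔ d ∣ n + 1 := by
      rw [← ZMod.natCast_eq_zero_iff]; push_cast; rfl
    simp only [h, Nat.succ_div]
    by_cases hd : d ∣ n + 1
    · simp [hd, pow_succ']
    · simp [hd]

theorem wrapShift_pow_card [NeZero d] (z : Equiv.Perm Y) :
    wrapShift d z ^ d = fiberPerm d Y (fun _ => z) := by
  have key : ∀ (i : ZMod d) (y : Y), (wrapShift d z ^ i.val) (0, y) = (i, y) := by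
    intro i y
    rw [wrapShift_pow_zero, Nat.div_eq_of_lt (ZMod.val_lt i)]
    simp
  ext1 ⟨i, y⟩
  rw [← key i y, ← Equiv.Perm.mul_apply, ← pow_add, add_comm, pow_add, Equiv.Perm.mul_apply,
    wrapShift_pow_zero, Nat.div_self (NeZero.pos d), key]
  simp [key]

theorem wrapShift_pow_fst (z : Equiv.Perm Y) (n : ℕ) (p : ZMod d × Y) :
    ((wrapShift d z ^ n) p).1 = p.1 + n := by
  induction n with
  | zero => simp
  | succ n ih => rw [pow_succ', Equiv.Perm.mul_apply, wrapShift_apply, ih]; push_cast; ring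

theorem wrapShift_mul_fiberPerm (z : Equiv.Perm Y) (f : ZMod d → Equiv.Perm Y)
    (hf : ∀ i, Commute z (f i)) :
    wrapShift d z * fiberPerm d Y f = fiberPerm d Y (fun i => f (i - 1)) * wrapShift d z := by
  ext1 ⟨i, y⟩
  have h := congrArg (fun σ : Equiv.Perm Y => σ y) (hf i).eq
  simp only [Equiv.Perm.mul_apply] at h
  by_cases hi : i + 1 = 0
  · have : -1 = i := by linear_combination -hi
    subst this
    simp [wrapShift_apply, h]
  · simp [wrapShift_apply, hi]

variable {W : Type*} [Group W]

/-- The homomorphism from `ℤ/k`, where `k = t * d` and `z ^ t = 1`, generated by `wrapShift`. -/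
def wrapShiftHom (d : ℕ) [NeZero d] {k t : ℕ} (hk : k = t * d) (z : Equiv.Perm Y)
    (hz : z ^ t = 1) : CyclicGroup k →* Equiv.Perm (ZMod d × Y) :=
  AddMonoidHom.toMultiplicativeLeft (ZMod.lift k
    ⟨zmultiplesHom (Additive (Equiv.Perm (ZMod d × Y))) (Additive.ofMul (wrapShift d z)), by
      change wrapShift d z ^ ((k : ℕ) : ℤ) = 1
      rw [zpow_natCast, hk, mul_comm, pow_mul, wrapShift_pow_card, ← map_pow]
      have : (fun _ : ZMod d => z) ^ t = 1 := by funext i; simp [hz]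
      rw [this, map_one]⟩)

theorem wrapShiftHom_natCast [NeZero d] {k t : ℕ} (hk : k = t * d) (z : Equiv.Perm Y)
    (hz : z ^ t = 1) (n : ℕ) :
    wrapShiftHom d hk z hz (Multiplicative.ofAdd (n : ZMod k)) = wrapShift d z ^ n := by
  have : (n : ZMod k) = ((n : ℤ) : ZMod k) := by simp
  rw [this]
  change Additive.toMul (ZMod.lift k _ _) = _
  erw [ZMod.lift_coe]
  exact zpow_natCast _ _

theorem CyclicGroup.exists_natCast {k : ℕ} [NeZero k] (a : CyclicGroup k) :
    ∃ n : ℕ, a = Multiplicative.ofAdd (n : ZMod k) :=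
  ⟨a.toAdd.val, by simp⟩

theorem wrapShift_pow_mul_fiberPerm (z : Equiv.Perm Y) (f : ZMod d → Equiv.Perm Y)
    (hf : ∀ i, Commute z (f i)) (n : ℕ) :
    wrapShift d z ^ n * fiberPerm d Y f =
      fiberPerm d Y (fun i => f (i - n)) * wrapShift d z ^ n := by
  induction n with
  | zero => simp
  | succ n ih =>
    rw [pow_succ', mul_assoc, ih, ← mul_assoc, wrapShift_mul_fiberPerm z _ (fun i => hf _),
      mul_assoc]
    congr 3
    funext i
    push_cast
    congr 1
    ring

/-- The cyclic wreath product of a permutation group of `Y`, acting on `ZMod d × Y`. -/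
def wreathToPerm [NeZero d] {k t : ℕ} [NeZero k] (hk : k = t * d) (hdk : d ∣ k)
    (ρ : W →* Equiv.Perm Y) (z : Equiv.Perm Y) (hz : z ^ t = 1)
    (hcomm : ∀ w, Commute z (ρ w)) : CyclicWreath W hdk →* Equiv.Perm (ZMod d × Y) :=
  SemidirectProduct.lift ((fiberPerm d Y).comp (ρ.compLeft (ZMod d))) (wrapShiftHom d hk z hz)
    (by
      intro a
      obtain ⟨n, rfl⟩ := CyclicGroup.exists_natCast a
      ext1 f
      simp only [MonoidHom.comp_apply, MulEquiv.coe_toMonoidHom, MulAut.conj_apply,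
        wrapShiftHom_natCast]
      rw [wrapShift_pow_mul_fiberPerm z (ρ.compLeft (ZMod d) f) (fun i => hcomm _),
        mul_inv_cancel_right]
      congr 1
      funext i
      change ρ (f (i - ZMod.castHom hdk (ZMod d) (n : ZMod k))) = ρ (f (i - n))
      rw [map_natCast])

/-- For an element of the kernel, the motion of the fibres forces `d ∣ n`. The remaining power `z ^
j` then lies in the range of `ρ`, so `t ∣ j` and the cyclic part is trivial. -/
theorem wreathToPerm_injective [NeZero d] [Nonempty Y] {k t : ℕ} [NeZero k] (hk : k = t * d)
    (hdk : d ∣ k) (ρ : W →* Equiv.Perm Y) (hρ : Function.Injective ρ) (z : Equiv.Perm Y)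
    (hz : z ^ t = 1) (hcomm : ∀ w, Commute z (ρ w)) (hzt : ∀ j : ℕ, z ^ j ∈ ρ.range → t ∣ j) :
    Function.Injective (wreathToPerm hk hdk ρ z hz hcomm) := by
  rw [injective_iff_map_eq_one]
  rintro ⟨f, a⟩ h
  obtain ⟨n, rfl⟩ := CyclicGroup.exists_natCast a
  have h' : fiberPerm d Y (fun i => ρ (f i)) * wrapShift d z ^ n = 1 := by
    rw [← h, ← wrapShiftHom_natCast hk z hz n]; rfl
  have hn : d ∣ n := by
    obtain ⟨y⟩ := ‹Nonempty Y›
    have := congrArg (fun σ : Equiv.Perm _ => (σ (0, y)).1) h'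
    simp only [Equiv.Perm.mul_apply, fiberPerm_apply, wrapShift_pow_fst] at this
    simpa [ZMod.natCast_eq_zero_iff] using this
  obtain ⟨j, rfl⟩ := hn
  rw [pow_mul, wrapShift_pow_card, ← map_pow, ← map_mul, ← map_one (fiberPerm d Y)] at h'
  have h2 := fiberPerm_injective h'
  have h3 : ∀ i, ρ (f i) * z ^ j = 1 := fun i => congrFun h2 i
  have hj : t ∣ j := hzt j ⟨(f 0)⁻¹, by rw [map_inv]; exact inv_eq_of_mul_eq_one_right (h3 0)⟩
  obtain ⟨l, rfl⟩ := hj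
  have hf : f = 1 := by
    funext i
    have := h3 i
    rw [pow_mul, hz, one_pow, mul_one] at this
    exact hρ (this.trans (map_one ρ).symm)
  subst hf
  have h0 : ((d * (t * l) : ℕ) : ZMod k) = 0 := by
    rw [ZMod.natCast_eq_zero_iff, hk]; exact ⟨l, by ring⟩
  rw [h0]
  rfl

/-- The group generated by a wrapped shift and a permutation of the fibre over `0` is a cyclic
wreath product. -/
theorem closure_wrapShift_mulEquiv [NeZero d] [Nonempty Y] {k t : ℕ} [NeZero k] (hk : k = t * d)
    (hdk : d ∣ k) (ρ : W →* Equiv.Perm Y) (hρ : Function.Injective ρ) (z : Equiv.Perm Y)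
    (hz : z ^ t = 1) (hcomm : ∀ w, Commute z (ρ w)) (hzt : ∀ j : ℕ, z ^ j ∈ ρ.range → t ∣ j)
    (q w : W)
    (hgen : ∀ L : Subgroup (Equiv.Perm Y),
      (∀ j : ℕ, (ρ w * z) ^ j * ρ q * ((ρ w * z) ^ j)⁻¹ ∈ L) → ρ.range ≤ L) :
    Nonempty (Subgroup.closure {wrapShift d (ρ w * z), fiberPerm d Y (Pi.mulSingle 0 (ρ q))} ≃*
      CyclicWreath W hdk) := by
  classical
  set Ψ := wreathToPerm hk hdk ρ z hz hcomm
  set G := Subgroup.closure {wrapShift d (ρ w * z), fiberPerm d Y (Pi.mulSingle 0 (ρ q))} with hG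
  have hΨl : ∀ f, Ψ (SemidirectProduct.inl f) = fiberPerm d Y (fun i => ρ (f i)) := fun f => by
    simp [Ψ, wreathToPerm]; rfl
  have hΨr : ∀ n : ℕ, Ψ (SemidirectProduct.inr (Multiplicative.ofAdd (n : ZMod k))) =
      wrapShift d z ^ n := fun n => by
    simp [Ψ, wreathToPerm, wrapShiftHom_natCast]
  have hsingle : ∀ (i : ZMod d) (x : W),
      (fun j => ρ ((Pi.mulSingle i x : ZMod d → W) j)) = Pi.mulSingle i (ρ x) := fun i x => by
    funext j
    exact Pi.apply_mulSingle (fun _ => ρ) (fun _ => map_one ρ) i x j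
  have hcG : wrapShift d (ρ w * z) ∈ G := Subgroup.subset_closure (by simp)
  have hqG : fiberPerm d Y (Pi.mulSingle 0 (ρ q)) ∈ G := Subgroup.subset_closure (by simp)
  -- The `d`-th power of the wrapped shift is `ρ w * z` on every fibre, so conjugating by its powers
  -- keeps `ρ q` inside fibre 0 and `hgen` applies there.
  have h0 : ∀ x : W, fiberPerm d Y (Pi.mulSingle 0 (ρ x)) ∈ G := by
    intro x
    have := hgen (G.comap ((fiberPerm d Y).comp
        (MonoidHom.mulSingle (fun _ : ZMod d => Equiv.Perm Y) 0))) (fun j => by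
      have hm := G.mul_mem (G.mul_mem (G.pow_mem (G.pow_mem hcG d) j) hqG)
        (G.inv_mem (G.pow_mem (G.pow_mem hcG d) j))
      rw [wrapShift_pow_card, ← map_pow, ← map_inv, ← map_mul, ← map_mul] at hm
      rw [Subgroup.mem_comap]
      convert hm using 1
      rw [MonoidHom.comp_apply]
      congr 1
      funext i
      by_cases hi : i = 0
      · subst hi; simp
      · simp [hi])
    exact this ⟨x, rfl⟩
  -- With `ρ w` on fibre 0 available, it can be divided off the first generator.
  have hzG : wrapShift d z ∈ G := by
    have := wrapShift_eq_mul (d := d) (ρ w) z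
    rw [← inv_mul_eq_iff_eq_mul] at this
    rw [← this]
    exact G.mul_mem (G.inv_mem (h0 w)) hcG
  -- Conjugation by the shift carries fibre 0 to fibre `n`, without distortion because `z` commutes
  -- with `ρ`.
  have hi : ∀ (n : ℕ) (x : W), fiberPerm d Y (Pi.mulSingle (n : ZMod d) (ρ x)) ∈ G := by
    intro n x
    have := wrapShift_pow_mul_fiberPerm (d := d) z (Pi.mulSingle 0 (ρ x)) (fun i => by
      rw [← hsingle]; exact hcomm _) n
    rw [← mul_inv_eq_iff_eq_mul] at this
    have hf : (fun i => (Pi.mulSingle 0 (ρ x) : ZMod d → Equiv.Perm Y) (i - n)) =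
        Pi.mulSingle (n : ZMod d) (ρ x) := by
      funext i
      simp only [Pi.mulSingle_apply, sub_eq_zero]
    rw [← hf, ← this]
    exact G.mul_mem (G.mul_mem (G.pow_mem hzG n) (h0 x)) (G.inv_mem (G.pow_mem hzG n))
  have hrange : Ψ.range = G := by
    apply le_antisymm
    · rintro _ ⟨⟨f, a⟩, rfl⟩
      rw [SemidirectProduct.mk_eq_inl_mul_inr, map_mul]
      refine G.mul_mem ?_ ?_
      · have : (⊤ : Subgroup (ZMod d → W)) ≤ G.comap (Ψ.comp SemidirectProduct.inl) := by
          intro f _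
          refine Subgroup.pi_mem_of_mulSingle_mem f fun i => ?_
          rw [Subgroup.mem_comap, MonoidHom.comp_apply, hΨl, hsingle,
            ← ZMod.natCast_zmod_val i]
          exact hi _ _
        exact this (Subgroup.mem_top f)
      · obtain ⟨n, rfl⟩ := CyclicGroup.exists_natCast a
        rw [hΨr]
        exact G.pow_mem hzG n
    · rw [hG, Subgroup.closure_le]
      rintro _ (rfl | rfl)
      · rw [wrapShift_eq_mul]
        refine Ψ.range.mul_mem ⟨SemidirectProduct.inl (Pi.mulSingle 0 w), ?_⟩
          ⟨SemidirectProduct.inr (Multiplicative.ofAdd ((1 : ℕ) : ZMod k)), ?_⟩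
        · rw [hΨl, hsingle]
        · rw [hΨr, pow_one]
      · exact ⟨SemidirectProduct.inl (Pi.mulSingle 0 q), by rw [hΨl, hsingle]⟩
  rw [← hrange]
  exact ⟨(MonoidHom.ofInjective
    (wreathToPerm_injective hk hdk ρ hρ z hz hcomm hzt)).symm⟩

/-- Isomorphic groups have isomorphic cyclic wreath products. -/
def CyclicWreath.congr {H H' : Type*} [Group H] [Group H'] (e : H ≃* H') {d k : ℕ} (h : d ∣ k) :
    CyclicWreath H h ≃* CyclicWreath H' h :=
  SemidirectProduct.congr (MulEquiv.piCongrRight fun _ => e) (MulEquiv.refl _)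
    (fun _ => by ext; rfl)

end Wreath

/-! ### Signed permutations and the rotation group -/

section SignedPerm

/-- The generator of `ℤ/2`. -/
abbrev CyclicGroup.gen : CyclicGroup 2 := Multiplicative.ofAdd 1

theorem CyclicGroup.mul_self_two (x : CyclicGroup 2) : x * x = 1 := by revert x; decide

theorem CyclicGroup.eq_one_or_gen (x : CyclicGroup 2) : x = 1 ∨ x = gen := by revert x; decide

/-- The isomorphism of `ℤ/2` with `{±1}`. -/
def CyclicGroup.toUnits : CyclicGroup 2 ≃* ℤˣ where
  toFun x := if x = 1 then 1 else -1
  invFun u := if u = 1 then 1 else gen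
  left_inv := by unfold Function.LeftInverse; decide
  right_inv := by unfold Function.RightInverse Function.LeftInverse; decide
  map_mul' := by decide

theorem CyclicGroup.toUnits_gen : toUnits gen = -1 := by decide

variable {α : Type*}

/-- Permutations of `α` acting on the vectors of `(ℤ/2)^α` by permuting the coordinates. -/
def coordAction (α : Type*) : Equiv.Perm α →* MulAut (α → CyclicGroup 2) where
  toFun π :=
    { toFun := fun v x => v (π⁻¹ x)
      invFun := fun v x => v (π x)
      left_inv := fun v => by ext; simp
      right_inv := fun v => by ext; simp
      map_mul' := fun _ _ => rfl }
  map_one' := by ext; rfl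
  map_mul' := fun _ _ => by ext; simp [MulAut.mul_apply]

@[simp] theorem coordAction_apply (π : Equiv.Perm α) (v : α → CyclicGroup 2) (x : α) :
    coordAction α π v x = v (π⁻¹ x) := rfl

/-- The group of signed permutations of `α`. -/
abbrev SignedPerm (α : Type*) : Type _ := (α → CyclicGroup 2) ⋊[coordAction α] Equiv.Perm α

namespace SignedPerm

/-- Signed permutations as permutations of the signed points. -/
def toPerm (α : Type*) : SignedPerm α →* Equiv.Perm (α × CyclicGroup 2) :=
  MonoidHom.toHomPerm
    { toFun := fun g p => (g.right p.1, g.left (g.right p.1) * p.2)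
      map_one' := by
        funext p
        simp [Function.End.one_def]
      map_mul' := fun g h => by
        funext p
        simp [mul_assoc]
        rfl }

@[simp] theorem toPerm_apply (g : SignedPerm α) (p : α × CyclicGroup 2) :
    toPerm α g p = (g.right p.1, g.left (g.right p.1) * p.2) := rfl

theorem toPerm_injective : Function.Injective (toPerm α) := by
  intro g h hgh
  have h1 : ∀ x, g.right x = h.right x ∧ g.left (g.right x) = h.left (h.right x) := fun x => by
    have := congrArg (fun σ : Equiv.Perm _ => σ (x, 1)) hgh
    simpa using this
  have h2 : g.right = h.right := Equiv.ext fun x => (h1 x).1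
  refine SemidirectProduct.ext (funext fun x => ?_) h2
  have := (h1 (g.right⁻¹ x)).2
  rw [← h2] at this
  simpa using this

theorem conj_inl (g : SignedPerm α) (v : α → CyclicGroup 2) :
    g * SemidirectProduct.inl v * g⁻¹ = SemidirectProduct.inl (coordAction α g.right v) := by
  rw [mul_inv_eq_iff_eq_mul]
  refine SemidirectProduct.ext ?_ ?_
  · simp [mul_comm]
  · simp

variable [Fintype α] [DecidableEq α]

/-- The determinant of a signed permutation matrix. -/
def det (α : Type*) [Fintype α] [DecidableEq α] : SignedPerm α →* ℤˣ where
  toFun g := CyclicGroup.toUnits (∏ x, g.left x) * Equiv.Perm.sign g.right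
  map_one' := by simp
  map_mul' g h := by
    have : ∏ x, coordAction α g.right h.left x = ∏ x, h.left x :=
      Equiv.prod_comp g.right⁻¹ h.left
    simp only [SemidirectProduct.mul_left, SemidirectProduct.mul_right, Pi.mul_apply,
      Finset.prod_mul_distrib, this, map_mul]
    exact mul_mul_mul_comm _ _ _ _

theorem det_apply (g : SignedPerm α) :
    det α g = CyclicGroup.toUnits (∏ x, g.left x) * Equiv.Perm.sign g.right := rfl

/-- The group of rotations among the signed permutations. -/
abbrev rotation (α : Type*) [Fintype α] [DecidableEq α] : Subgroup (SignedPerm α) := (det α).ker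

theorem mem_rotation {g : SignedPerm α} :
    g ∈ rotation α ↔ CyclicGroup.toUnits (∏ x, g.left x) = Equiv.Perm.sign g.right := by
  rw [MonoidHom.mem_ker, det_apply, mul_eq_one_iff_eq_inv, Int.units_inv_eq_self]

/-- The signed transposition of `x` and `y`, of order `4`. -/
def signedSwap (x y : α) : SignedPerm α :=
  ⟨Pi.mulSingle x CyclicGroup.gen, Equiv.swap x y⟩

theorem signedSwap_mem_rotation {x y : α} (h : x ≠ y) : signedSwap x y ∈ rotation α := by
  rw [mem_rotation]
  simp [signedSwap, Equiv.Perm.sign_swap h, CyclicGroup.toUnits_gen]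

/-- Each nontrivial coordinate is paired with a fixed base coordinate `b`; the contributions at `b`
cancel because the product of all coordinates is trivial. -/
theorem inl_mem_of_prod_eq_one (L : Subgroup (SignedPerm α))
    (hL : ∀ x y : α, SemidirectProduct.inl
      (Pi.mulSingle x CyclicGroup.gen * Pi.mulSingle y CyclicGroup.gen) ∈ L)
    (v : α → CyclicGroup 2) (hv : ∏ x, v x = 1) : SemidirectProduct.inl v ∈ L := by
  rcases isEmpty_or_nonempty α with hα | ⟨⟨b⟩⟩
  · rw [Subsingleton.elim v 1, map_one]; exact L.one_mem
  have hprod : v = ∏ x, (Pi.mulSingle x (v x) * Pi.mulSingle b (v x)) := by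
    rw [Finset.prod_mul_distrib, Finset.univ_prod_mulSingle]
    have : ∏ x, (Pi.mulSingle b (v x) : α → CyclicGroup 2) = Pi.mulSingle b (∏ x, v x) :=
      (map_prod (MonoidHom.mulSingle (fun _ : α => CyclicGroup 2) b) v Finset.univ).symm
    rw [this, hv, Pi.mulSingle_one, mul_one]
  change v ∈ L.comap SemidirectProduct.inl
  rw [hprod]
  refine Subgroup.prod_mem _ fun x _ => ?_
  rcases CyclicGroup.eq_one_or_gen (v x) with h | h
  · rw [h]; simp only [Pi.mulSingle_one, mul_one]; exact Subgroup.one_mem _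
  · rw [h]; exact hL x b

/-- The conjugates of a signed transposition under the powers of `c` generate the rotation group,
as soon as the underlying transpositions generate a transitive group. -/
theorem rotation_le_of_conj_signedSwap_mem (c : SignedPerm α) {x y : α} (hxy : x ≠ y)
    (htrans : MulAction.IsPretransitive (Subgroup.closure (Set.range fun j : ℕ =>
      c.right ^ j * Equiv.swap x y * (c.right ^ j)⁻¹)) α)
    (L : Subgroup (SignedPerm α)) (hL : ∀ j : ℕ, c ^ j * signedSwap x y * (c ^ j)⁻¹ ∈ L) :
    rotation α ≤ L := by
  -- A transitive group generated by transpositions is the full symmetric group. Lifts are kept in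
  -- `rotation α` so that quotients of rotations by them have even sign vectors.
  have hright : ∀ π : Equiv.Perm α, ∃ g ∈ L ⊓ rotation α, g.right = π := by
    have : (L ⊓ rotation α).map SemidirectProduct.rightHom = ⊤ := by
      rw [eq_top_iff, ← closure_of_isSwap_of_isPretransitive (S := Set.range fun j : ℕ =>
        c.right ^ j * Equiv.swap x y * (c.right ^ j)⁻¹), Subgroup.closure_le]
      · rintro _ ⟨j, rfl⟩
        refine ⟨c ^ j * signedSwap x y * (c ^ j)⁻¹, ⟨hL j, ?_⟩, ?_⟩
        · exact (MonoidHom.normal_ker _).conj_mem _ (signedSwap_mem_rotation hxy) _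
        · simp only [map_mul, map_inv, map_pow]
          rfl
      · rintro _ ⟨j, rfl⟩
        refine ⟨(c.right ^ j) x, (c.right ^ j) y, fun h => hxy ((c.right ^ j).injective h), ?_⟩
        exact (Equiv.swap_apply_apply _ _ _).symm
    intro π
    have hπ : π ∈ (L ⊓ rotation α).map SemidirectProduct.rightHom := by rw [this]; trivial
    exact hπ
  -- The square of a quarter turn changes the signs at `x` and `y`.
  have hsq : SemidirectProduct.inl
      (Pi.mulSingle x CyclicGroup.gen * Pi.mulSingle y CyclicGroup.gen) ∈ L := by
    have h0 := hL 0
    rw [pow_zero, one_mul, inv_one, mul_one] at h0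
    convert L.mul_mem h0 h0 using 1
    refine SemidirectProduct.ext ?_ ?_
    · simp only [signedSwap, SemidirectProduct.mul_left, SemidirectProduct.left_inl]
      congr 1
      funext u
      simp only [coordAction_apply, Pi.mulSingle_apply, Equiv.swap_inv]
      congr 1
      rw [Equiv.swap_apply_eq_iff, Equiv.swap_apply_left]
    · simp [signedSwap]
  have hpair : ∀ u v : α, SemidirectProduct.inl
      (Pi.mulSingle u CyclicGroup.gen * Pi.mulSingle v CyclicGroup.gen) ∈ L := by
    intro u v
    by_cases huv : u = v
    · subst huv
      rw [← Pi.mulSingle_mul, CyclicGroup.mul_self_two, Pi.mulSingle_one, map_one]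
      exact L.one_mem
    -- The first swap takes `x` to `u`; the second takes the image of `y` to `v` and leaves `u`
    -- alone.
    obtain ⟨g, hg, hgπ⟩ := hright (Equiv.swap (Equiv.swap x u y) v * Equiv.swap x u)
    have hx : g.right x = u := by
      rw [hgπ, Equiv.Perm.mul_apply, Equiv.swap_apply_left, Equiv.swap_apply_of_ne_of_ne _ huv]
      intro h
      apply hxy
      rw [← (Equiv.swap x u).apply_eq_iff_eq, Equiv.swap_apply_left, ← h]
    have hy : g.right y = v := by
      rw [hgπ, Equiv.Perm.mul_apply, Equiv.swap_apply_left]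
    have := L.mul_mem (L.mul_mem hg.1 hsq) (L.inv_mem hg.1)
    rw [conj_inl] at this
    convert this using 2
    funext w
    simp only [coordAction_apply, Pi.mul_apply, Pi.mulSingle_apply, Equiv.Perm.inv_eq_iff_eq,
      hx, hy]
  intro g hg
  obtain ⟨l, hl, hlg⟩ := hright g.right
  have hr : (g * l⁻¹).right = 1 := by simp [hlg]
  have hm : g * l⁻¹ ∈ rotation α := Subgroup.mul_mem _ hg (Subgroup.inv_mem _ hl.2)
  have hinl : g * l⁻¹ = SemidirectProduct.inl (g * l⁻¹).left :=
    SemidirectProduct.ext rfl hr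
  have : g * l⁻¹ ∈ L := by
    rw [hinl]
    refine inl_mem_of_prod_eq_one L hpair _ ?_
    rw [mem_rotation, hr, map_one] at hm
    exact (MulEquiv.map_eq_one_iff _).1 hm
  simpa using L.mul_mem this hl.1

end SignedPerm
end SignedPerm

/-! ### Internal semidirect products and affine actions -/

section Complements

/-- The conjugation formula for `φ` is part of the conclusion because the faithfulness of the action
on the quaternion group is deduced from it. -/
theorem exists_mulEquiv_semidirectProduct {N H W : Type*} [Group N] [Group H] [Group W]
    (i : N →* W) (j : H →* W) (hi : Function.Injective i) (hj : Function.Injective j)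
    (hn : i.range.Normal) (hc : Subgroup.IsComplement' i.range j.range) :
    ∃ φ : H →* MulAut N, (∀ h n, i (φ h n) = j h * i n * (j h)⁻¹) ∧
      Nonempty (W ≃* N ⋊[φ] H) := by
  let e : i.range ≃* N := (MonoidHom.ofInjective hi).symm
  let φ : H →* MulAut N := (MulAut.congr e).toMonoidHom.comp (MulAut.conjNormal.comp j)
  have he : ∀ x : i.range, i (e x) = x := fun x => by
    obtain ⟨x, n, rfl⟩ := x
    exact congrArg i (MonoidHom.ofInjective hi |>.symm_apply_apply n)
  have hφ : ∀ h n, i (φ h n) = j h * i n * (j h)⁻¹ := by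
    intro h n
    change i (e (MulAut.conjNormal (j h) (e.symm n))) = _
    rw [he, MulAut.conjNormal_apply]
    rfl
  let F : N ⋊[φ] H →* W := SemidirectProduct.lift i j (fun h => by
    ext n
    simp [hφ])
  have hF : ∀ x, F x = i x.left * j x.right := fun x => rfl
  refine ⟨φ, hφ, ⟨(MulEquiv.ofBijective F ⟨?_, ?_⟩).symm⟩⟩
  · rw [injective_iff_map_eq_one]
    intro x hx
    rw [hF] at hx
    have h1 : i x.left ∈ i.range ⊓ j.range :=
      ⟨⟨_, rfl⟩, ⟨x.right⁻¹, by rw [map_inv]; exact (eq_inv_of_mul_eq_one_left hx).symm⟩⟩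
    rw [hc.disjoint.eq_bot, Subgroup.mem_bot] at h1
    rw [h1, one_mul] at hx
    exact SemidirectProduct.ext (hi (h1.trans (map_one i).symm)) (hj (hx.trans (map_one j).symm))
  · intro w
    obtain ⟨⟨⟨_, n, rfl⟩, ⟨_, h, rfl⟩⟩, hw⟩ := hc.surjective w
    exact ⟨⟨n, h⟩, hw⟩

/-- A semidirect product acts on its normal factor by affine maps. -/
def SemidirectProduct.affineHom {N H : Type*} [Group N] [Group H] (φ : H →* MulAut N) :
    N ⋊[φ] H →* Equiv.Perm N :=
  SemidirectProduct.lift (MulAction.toPermHom N N) ((MulAut.toPerm N).comp φ) (fun h => by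
    ext n x
    change φ h n * x = φ h (n * (φ h).symm x)
    simp)

theorem SemidirectProduct.affineHom_injective {N H : Type*} [Group N] [Group H]
    (φ : H →* MulAut N) (hφ : Function.Injective φ) : Function.Injective (affineHom φ) := by
  rw [injective_iff_map_eq_one]
  intro x hx
  have h : ∀ n, x.left * φ x.right n = n := fun n => congrArg (fun σ : Equiv.Perm N => σ n) hx
  have hl : x.left = 1 := by simpa using h 1
  refine SemidirectProduct.ext hl (hφ (MulEquiv.ext fun n => ?_))
  have := h n
  rw [hl, one_mul] at this
  simpa using this

end Complements

/-! ### Semidirect decompositions of the rotation group -/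

theorem EvenVec.card (m : ℕ) : Nat.card (EvenVec m) = 2 ^ (m - 1) := by
  obtain ⟨e⟩ := EvenVec.nonempty_mulEquiv m
  rw [Nat.card_congr e.toEquiv]
  simp [CyclicGroup]

theorem permAction_three_injective : Function.Injective (permAction 3) := by
  rw [injective_iff_map_eq_one]
  intro π hπ
  have h : ∀ v : Fin 3 → CyclicGroup 2, ∏ i, v i = 1 → ∀ i, v (π⁻¹ i) = v i := fun v hv i =>
    congrFun (congrArg Subtype.val (congrArg (fun σ : MulAut (EvenVec 3) => σ ⟨v, hv⟩) hπ)) i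
  clear hπ
  revert π
  decide

/-- The left side acts faithfully by affine maps on the four elements of `EvenVec 3`, and its order
is 4 · 6 = 4!. -/
theorem perm_four_mulEquiv :
    Nonempty (EvenVec 3 ⋊[permAction 3] Equiv.Perm (Fin 3) ≃* Equiv.Perm (Fin 4)) := by
  have hc : Nat.card (EvenVec 3) = 4 := EvenVec.card 3
  have : Finite (EvenVec 3) := Nat.finite_of_card_ne_zero (by omega)
  have e : EvenVec 3 ≃ Fin 4 := Finite.equivFinOfCardEq hc
  refine ⟨(MulEquiv.ofBijective _ (Function.Injective.bijective_of_nat_card_le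
    (SemidirectProduct.affineHom_injective _ permAction_three_injective) ?_)).trans
      e.permCongrHom⟩
  rw [Nat.card_perm, SemidirectProduct.card, hc, Nat.card_perm]
  simp
  decide

namespace SignedPerm

/-- In odd dimension the scalar `u = ±1` has determinant `u`, so scaling a permutation matrix by its
sign makes it a rotation. -/
theorem det_inl_const {m : ℕ} (hm : Odd m) (u : ℤˣ) :
    CyclicGroup.toUnits (∏ _ : Fin m, CyclicGroup.toUnits.symm u) = u := by
  rw [Finset.prod_const, Finset.card_univ, Fintype.card_fin, map_pow, MulEquiv.apply_symm_apply]
  obtain ⟨k, rfl⟩ := hm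
  rw [pow_succ, pow_mul, Int.units_sq, one_pow, one_mul]

/-- In odd dimension the rotations are the even sign changes times the permutation matrices
multiplied by their signs. -/
def rotationEquivOfOdd {m : ℕ} (hm : Odd m) :
    rotation (Fin m) ≃* EvenVec m ⋊[permAction m] Equiv.Perm (Fin m) where
  toFun g := ⟨⟨g.1.left * fun _ => CyclicGroup.toUnits.symm (Equiv.Perm.sign g.1.right), by
      change ∏ i, (g.1.left i * CyclicGroup.toUnits.symm (Equiv.Perm.sign g.1.right)) = 1
      rw [Finset.prod_mul_distrib, ← map_eq_one_iff _ CyclicGroup.toUnits.injective, map_mul,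
        det_inl_const hm, mem_rotation.1 g.2, Int.units_mul_self]⟩, g.1.right⟩
  invFun x := ⟨⟨x.left.1 * fun _ => CyclicGroup.toUnits.symm (Equiv.Perm.sign x.right), x.right⟩,
    by
      have : ∏ i, x.left.1 i = 1 := x.left.2
      rw [mem_rotation]
      simp only [Pi.mul_apply, Finset.prod_mul_distrib, det_inl_const hm, this, one_mul]⟩
  left_inv g := by
    refine Subtype.ext (SemidirectProduct.ext (funext fun i => ?_) rfl)
    simp [mul_assoc, CyclicGroup.mul_self_two]
  right_inv x := by
    refine SemidirectProduct.ext (Subtype.ext (funext fun i => ?_)) rfl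
    simp [mul_assoc, CyclicGroup.mul_self_two]
  map_mul' g h := by
    refine SemidirectProduct.ext (Subtype.ext (funext fun i => ?_)) rfl
    simp only [Subgroup.coe_mul, SemidirectProduct.mul_left, SemidirectProduct.mul_right,
      Pi.mul_apply, map_mul]
    exact mul_mul_mul_comm _ _ _ _

/-- The rotations with even underlying permutation. -/
def evenToRotation (m : ℕ) :
    EvenVec m ⋊[altAction m] alternatingGroup (Fin m) →* rotation (Fin m) :=
  (SemidirectProduct.map (EvenVec m).subtype (alternatingGroup (Fin m)).subtype
    (fun _ => rfl)).codRestrict _ (fun x => by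
      have h1 : ∏ i, x.left.1 i = 1 := x.left.2
      have h2 : Equiv.Perm.sign x.right.1 = 1 := x.right.2
      rw [mem_rotation]
      exact (congrArg CyclicGroup.toUnits h1).trans ((map_one _).trans h2.symm))

theorem evenToRotation_injective (m : ℕ) : Function.Injective (evenToRotation m) := by
  intro x y h
  have h := congrArg Subtype.val h
  exact SemidirectProduct.ext (Subtype.ext (congrArg SemidirectProduct.left h))
    (Subtype.ext (congrArg SemidirectProduct.right h))

theorem mem_range_evenToRotation {m : ℕ} {g : rotation (Fin m)} :
    g ∈ (evenToRotation m).range ↔ Equiv.Perm.sign g.1.right = 1 := by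
  constructor
  · rintro ⟨x, rfl⟩
    exact x.right.2
  · intro h
    have hg := mem_rotation.1 g.2
    rw [h] at hg
    exact ⟨⟨⟨g.1.left, (MulEquiv.map_eq_one_iff _).1 hg⟩, ⟨g.1.right, h⟩⟩, rfl⟩

theorem range_evenToRotation (m : ℕ) : (evenToRotation m).range =
    (Equiv.Perm.sign.comp (SemidirectProduct.rightHom.comp (rotation (Fin m)).subtype)).ker := by
  ext g
  exact mem_range_evenToRotation

theorem exists_rotation_mulEquiv {m : ℕ} (hm : 3 ≤ m) :
    ∃ ψ : CyclicGroup 2 →* MulAut (EvenVec m ⋊[altAction m] alternatingGroup (Fin m)),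
      Nonempty (rotation (Fin m) ≃*
        (EvenVec m ⋊[altAction m] alternatingGroup (Fin m)) ⋊[ψ] CyclicGroup 2) := by
  obtain ⟨m, rfl⟩ := Nat.exists_eq_add_of_le' hm
  have h01 : (0 : Fin (m + 3)) ≠ 1 := by simp
  have h2 : 2 % (m + 3) = 2 := Nat.mod_eq_of_lt (by omega)
  have h20 : (2 : Fin (m + 3)) ≠ 0 := by rw [Ne, Fin.ext_iff]; simp [h2]
  have h21 : (2 : Fin (m + 3)) ≠ 1 := by rw [Ne, Fin.ext_iff]; simp [h2]
  -- A lift of the swap of 0 and 1 whose sign sits at the third coordinate 2: as the swap fixes 2,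
  -- the lift is an involution, unlike `signedSwap 0 1`.
  let t : rotation (Fin (m + 3)) := ⟨⟨Pi.mulSingle 2 CyclicGroup.gen, Equiv.swap 0 1⟩, by
    rw [mem_rotation]
    simp [Equiv.Perm.sign_swap h01, CyclicGroup.toUnits_gen]⟩
  have htt : t * t = 1 := by
    refine Subtype.ext (SemidirectProduct.ext (funext fun i => ?_) (Equiv.swap_mul_self _ _))
    change (Pi.mulSingle 2 CyclicGroup.gen : Fin (m + 3) → CyclicGroup 2) i *
      (Pi.mulSingle 2 CyclicGroup.gen : Fin (m + 3) → CyclicGroup 2) ((Equiv.swap 0 1)⁻¹ i) = 1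
    have : (Equiv.swap (0 : Fin (m + 3)) 1)⁻¹ i = 2 ↔ i = 2 := by
      rw [Equiv.Perm.inv_eq_iff_eq, Equiv.swap_apply_of_ne_of_ne h20 h21]
    simp only [Pi.mulSingle_apply, this, CyclicGroup.mul_self_two]
  have hsign : Equiv.Perm.sign t.1.right = -1 := Equiv.Perm.sign_swap h01
  let j : CyclicGroup 2 →* rotation (Fin (m + 3)) :=
    { toFun := fun x => if x = 1 then 1 else t
      map_one' := rfl
      map_mul' := fun x y => by
        rcases CyclicGroup.eq_one_or_gen x with rfl | rfl <;>
          rcases CyclicGroup.eq_one_or_gen y with rfl | rfl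
        · simp
        · simp
        · simp
        · rw [CyclicGroup.mul_self_two, if_pos rfl, if_neg (by decide), htt] }
  have hjg : j CyclicGroup.gen = t := rfl
  have htN : t ∉ (evenToRotation (m + 3)).range := by
    rw [mem_range_evenToRotation, hsign]; decide
  have hj : ∀ x, j x ∈ (evenToRotation (m + 3)).range → x = 1 := by
    intro x hx
    rcases CyclicGroup.eq_one_or_gen x with rfl | rfl
    · rfl
    · exact absurd hx htN
  obtain ⟨ψ, -, h⟩ := exists_mulEquiv_semidirectProduct (evenToRotation (m + 3)) j
    (evenToRotation_injective _)
    ((injective_iff_map_eq_one _).2 fun x hx => hj x (hx ▸ Subgroup.one_mem _))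
    (by rw [range_evenToRotation]; exact MonoidHom.normal_ker _)
    (by
      apply Subgroup.isComplement'_of_disjoint_and_mul_eq_univ
      · rw [Subgroup.disjoint_def]
        rintro _ hx ⟨x, rfl⟩
        rw [hj x hx, map_one]
      · rw [Set.eq_univ_iff_forall]
        intro g
        rcases Int.units_eq_one_or (Equiv.Perm.sign g.1.right) with hg | hg
        · exact ⟨g, mem_range_evenToRotation.2 hg, 1, Subgroup.one_mem _, mul_one _⟩
        · refine ⟨g * t, mem_range_evenToRotation.2 ?_, t, ⟨_, hjg⟩, ?_⟩
          · change Equiv.Perm.sign (g.1.right * t.1.right) = 1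
            rw [map_mul, hg, hsign]; rfl
          · change g * t * t = g
            rw [mul_assoc, htt, mul_one])
  exact ⟨ψ, h⟩

theorem card_rotation_four : Nat.card (rotation (Fin 4)) = 192 := by
  obtain ⟨ψ, ⟨e⟩⟩ := exists_rotation_mulEquiv (m := 4) (by norm_num)
  have hA : Nat.card (alternatingGroup (Fin 4)) = 12 := by
    rw [nat_card_alternatingGroup]; simp; decide
  have hC : Nat.card (CyclicGroup 2) = 2 := by simp [CyclicGroup]
  rw [Nat.card_congr e.toEquiv, SemidirectProduct.card, SemidirectProduct.card, EvenVec.card, hA,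
    hC]
  rfl

end SignedPerm

/-! ### Dimension four and the quaternion group -/

namespace SignedPerm

/-- Left multiplication by the quaternion `i`, on the signed basis `1, i, j, k`. -/
def leftI : SignedPerm (Fin 4) :=
  ⟨![CyclicGroup.gen, 1, CyclicGroup.gen, 1], Equiv.swap 0 1 * Equiv.swap 2 3⟩

/-- Left multiplication by the quaternion `j`, on the signed basis `1, i, j, k`. -/
def leftJ : SignedPerm (Fin 4) :=
  ⟨![CyclicGroup.gen, 1, 1, CyclicGroup.gen], Equiv.swap 0 2 * Equiv.swap 1 3⟩

/-- Left multiplication by an element of the quaternion group. -/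
def leftQuaternion : QuaternionGroup 2 → SignedPerm (Fin 4)
  | .a k => leftI ^ k.val
  | .xa k => leftJ * leftI ^ k.val

theorem toPerm_leftQuaternion_mul : ∀ (x y : QuaternionGroup 2) (p : Fin 4 × CyclicGroup 2),
    toPerm _ (leftQuaternion (x * y)) p =
      toPerm _ (leftQuaternion x) (toPerm _ (leftQuaternion y) p) := by
  decide +kernel

/-- The left regular representation of the quaternion group by signed permutations. -/
def quaternionHom : QuaternionGroup 2 →* SignedPerm (Fin 4) where
  toFun := leftQuaternion
  map_one' := rfl
  map_mul' x y := toPerm_injective (by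
    ext1 p
    rw [toPerm_leftQuaternion_mul, map_mul, Equiv.Perm.mul_apply])

theorem toPerm_quaternionHom_fix : ∀ x : QuaternionGroup 2,
    toPerm _ (quaternionHom x) (0, 1) = (0, 1) → x = 1 := by
  decide +kernel

theorem toPerm_quaternionHom_transitive : ∀ p : Fin 4 × CyclicGroup 2,
    ∃ x : QuaternionGroup 2, toPerm _ (quaternionHom x) (0, 1) = p := by
  decide +kernel

theorem quaternionHom_injective : Function.Injective quaternionHom := by
  rw [injective_iff_map_eq_one]
  intro x hx
  apply toPerm_quaternionHom_fix
  rw [hx, map_one, Equiv.Perm.one_apply]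

theorem quaternionHom_mem_rotation : ∀ x, quaternionHom x ∈ rotation (Fin 4) := by
  have : ∀ x, det _ (quaternionHom x) = 1 := by decide +kernel
  exact this

/-- This quarter turn is `x ↦ a x a` with `a = (1 + i)/√2`. Right multiplication commutes with left
multiplications, and conjugation by `a` preserves the quaternion group. -/
theorem signedSwap_mul_quaternionHom : ∀ x, ∃ y, ∀ p,
    toPerm _ (signedSwap 0 1 * quaternionHom x) p =
      toPerm _ (quaternionHom y * signedSwap 0 1) p := by
  decide +kernel

/-- The cyclic permutation of `i, j, k`. -/
def cycleIJK : Equiv.Perm (Fin 4) := Equiv.swap 1 2 * Equiv.swap 2 3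

/-- The cycle of `i, j, k` is an automorphism of the quaternions, so it carries left multiplications
to left multiplications. -/
theorem cycleIJK_mul_quaternionHom : ∀ x, ∃ y, ∀ p,
    toPerm _ (SemidirectProduct.inr cycleIJK * quaternionHom x) p =
      toPerm _ (quaternionHom y * SemidirectProduct.inr cycleIJK) p := by
  decide +kernel

theorem mem_normalizer_range_quaternionHom {g : SignedPerm (Fin 4)}
    (h : ∀ x, ∃ y, ∀ p, toPerm _ (g * quaternionHom x) p = toPerm _ (quaternionHom y * g) p) :
    g ∈ Subgroup.normalizer (quaternionHom.range : Set (SignedPerm (Fin 4))) := by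
  have : Finite (quaternionHom.range : Set (SignedPerm (Fin 4))) := Set.finite_range quaternionHom
  apply Subgroup.mem_normalizer_fintype
  rintro _ ⟨x, rfl⟩
  obtain ⟨y, hy⟩ := h x
  refine ⟨y, ?_⟩
  rw [eq_mul_inv_iff_mul_eq]
  exact toPerm_injective (Equiv.ext fun p => (hy p).symm)

theorem isPretransitive_conj_cycleIJK : MulAction.IsPretransitive
    (Subgroup.closure (Set.range fun j : ℕ =>
      cycleIJK ^ j * Equiv.swap 0 1 * (cycleIJK ^ j)⁻¹)) (Fin 4) := by
  have h : ∀ x : Fin 4, x ≠ 0 → ∃ j < 3,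
      (cycleIJK ^ j * Equiv.swap 0 1 * (cycleIJK ^ j)⁻¹ : Equiv.Perm (Fin 4)) 0 = x := by
    decide +kernel
  rw [MulAction.isPretransitive_iff_base (0 : Fin 4)]
  intro x
  by_cases hx : x = 0
  · exact ⟨1, by rw [hx, one_smul]⟩
  · obtain ⟨j, -, hj⟩ := h x hx
    exact ⟨⟨_, Subgroup.subset_closure ⟨j, rfl⟩⟩, hj⟩

/-- The quarter turn in the plane of `1, i` and its conjugates under the cycle of `i, j, k` generate
all rotations, and all of them normalise the left multiplications. -/
theorem rotation_le_normalizer_range_quaternionHom : rotation (Fin 4) ≤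
    Subgroup.normalizer (quaternionHom.range : Set (SignedPerm (Fin 4))) := by
  apply rotation_le_of_conj_signedSwap_mem (SemidirectProduct.inr cycleIJK) (x := 0) (y := 1)
    (by decide) isPretransitive_conj_cycleIJK
  intro j
  have hc := Subgroup.pow_mem _ (mem_normalizer_range_quaternionHom cycleIJK_mul_quaternionHom) j
  exact Subgroup.mul_mem _ (Subgroup.mul_mem _ hc
    (mem_normalizer_range_quaternionHom signedSwap_mul_quaternionHom)) (Subgroup.inv_mem _ hc)

/-- The left regular representation of the quaternion group by rotations. -/
def quaternionToRotation : QuaternionGroup 2 →* rotation (Fin 4) :=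
  quaternionHom.codRestrict _ quaternionHom_mem_rotation

theorem normal_range_quaternionToRotation : quaternionToRotation.range.Normal := by
  constructor
  rintro _ ⟨x, rfl⟩ g
  obtain ⟨y, hy⟩ := (Subgroup.mem_normalizer_iff.1
    (rotation_le_normalizer_range_quaternionHom g.2) (quaternionHom x)).1 ⟨x, rfl⟩
  exact ⟨y, Subtype.ext hy⟩

/-- Extension of the permutations of `Fin n` to `Fin (n + 1)`, fixing `0`. -/
def extendPerm (n : ℕ) : Equiv.Perm (Fin n) →* Equiv.Perm (Fin (n + 1)) where
  toFun π := Equiv.Perm.decomposeFin.symm (0, π)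
  map_one' := by simp; rfl
  map_mul' π τ := by
    ext x
    refine Fin.cases ?_ (fun x => ?_) x <;> simp

theorem extendPerm_zero {n : ℕ} (π : Equiv.Perm (Fin n)) : extendPerm n π 0 = 0 := by
  simp [extendPerm]

theorem extendPerm_succ {n : ℕ} (π : Equiv.Perm (Fin n)) (i : Fin n) :
    extendPerm n π i.succ = (π i).succ := by
  simp [extendPerm]

theorem sign_extendPerm {n : ℕ} (π : Equiv.Perm (Fin n)) :
    Equiv.Perm.sign (extendPerm n π) = Equiv.Perm.sign π := by
  simp [extendPerm]

/-- Extension of the signed permutations of `Fin n` to `Fin (n + 1)`, fixing `0`. -/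
def extend (n : ℕ) : SignedPerm (Fin n) →* SignedPerm (Fin (n + 1)) :=
  SemidirectProduct.map
    { toFun := fun v => Fin.cons 1 v
      map_one' := by ext i; refine Fin.cases ?_ (fun i => ?_) i <;> rfl
      map_mul' := fun v w => by ext i; refine Fin.cases ?_ (fun i => ?_) i <;> simp }
    (extendPerm n)
    (fun π => by
      refine MonoidHom.ext fun v => funext fun i => ?_
      change (Fin.cons 1 (coordAction _ π v) : Fin (n + 1) → CyclicGroup 2) i =
        (Fin.cons 1 v : Fin (n + 1) → CyclicGroup 2) ((extendPerm n π)⁻¹ i)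
      rw [← map_inv]
      refine Fin.cases ?_ (fun i => ?_) i
      · rw [extendPerm_zero]; rfl
      · rw [extendPerm_succ]; rfl)

theorem det_extend {n : ℕ} (g : SignedPerm (Fin n)) : det _ (extend n g) = det _ g := by
  have : ∏ i, (Fin.cons 1 g.left : Fin (n + 1) → CyclicGroup 2) i = ∏ i, g.left i := by
    rw [Fin.prod_univ_succ, Fin.cons_zero, one_mul]; rfl
  rw [det_apply, det_apply, ← this, ← sign_extendPerm g.right]
  rfl

theorem toPerm_extend_zero {n : ℕ} (g : SignedPerm (Fin n)) :
    toPerm _ (extend n g) (0, 1) = (0, 1) := by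
  have h : (extend n g).right 0 = 0 := extendPerm_zero _
  rw [toPerm_apply, h]
  rfl

theorem extend_injective (n : ℕ) : Function.Injective (extend n) := by
  intro g h hgh
  refine SemidirectProduct.ext ?_ (Equiv.ext fun i => ?_)
  · exact Fin.cons_right_injective (α := fun _ => CyclicGroup 2) 1
      (congrArg SemidirectProduct.left hgh)
  · have : extendPerm n g.right i.succ = extendPerm n h.right i.succ :=
      congrArg (fun σ : Equiv.Perm _ => σ i.succ) (congrArg SemidirectProduct.right hgh)
    rw [extendPerm_succ, extendPerm_succ] at this
    exact Fin.succ_injective _ this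

/-- Extension of the rotations of `Fin n` to `Fin (n + 1)`, fixing `0`. -/
def extendRotation (n : ℕ) : rotation (Fin n) →* rotation (Fin (n + 1)) :=
  ((extend n).comp (rotation (Fin n)).subtype).codRestrict _
    (fun g => by
      rw [MonoidHom.mem_ker]
      exact (det_extend _).trans g.2)

theorem rotation_three_mulEquiv : Nonempty (rotation (Fin 3) ≃* Equiv.Perm (Fin 4)) :=
  perm_four_mulEquiv.map fun e => (rotationEquivOfOdd (by decide)).trans e

/-- The rotation group of the four-dimensional cross-polytope is the holomorph of the
quaternion group. -/
theorem exists_rotation_four_mulEquiv :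
    ∃ θ : Equiv.Perm (Fin 4) →* MulAut (QuaternionGroup 2), Function.Injective θ ∧
      Nonempty (rotation (Fin 4) ≃* QuaternionGroup 2 ⋊[θ] Equiv.Perm (Fin 4)) := by
  obtain ⟨e⟩ := rotation_three_mulEquiv
  let j : Equiv.Perm (Fin 4) →* rotation (Fin 4) := (extendRotation 3).comp e.symm.toMonoidHom
  have hjfix : ∀ h, toPerm _ (j h).1 (0, 1) = (0, 1) := fun h => toPerm_extend_zero _
  have hj : Function.Injective j := fun x y h =>
    e.symm.injective (Subtype.ext (extend_injective 3 (congrArg Subtype.val h)))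
  have hi : Function.Injective quaternionToRotation := fun x y h =>
    quaternionHom_injective (congrArg Subtype.val h)
  obtain ⟨θ, hθ, hW⟩ := exists_mulEquiv_semidirectProduct quaternionToRotation j hi hj
    normal_range_quaternionToRotation (by
      have : Finite (rotation (Fin 4)) :=
        Nat.finite_of_card_ne_zero (by rw [card_rotation_four]; decide)
      -- The orders match, 8 · 24 = 192, and the intersection is trivial since a left multiplication
      -- fixing the point 1 is the identity.
      apply Subgroup.isComplement'_of_card_mul_and_disjoint
      · rw [card_rotation_four, ← Nat.card_congr (MonoidHom.ofInjective hi).toEquiv,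
          ← Nat.card_congr (MonoidHom.ofInjective hj).toEquiv, Nat.card_eq_fintype_card,
          QuaternionGroup.card,
          Nat.card_perm]
        simp
        decide
      · rw [Subgroup.disjoint_def]
        rintro _ ⟨x, rfl⟩ ⟨y, hy⟩
        have : x = 1 := toPerm_quaternionHom_fix x (by
          have := hjfix y
          rw [hy] at this
          exact this)
        rw [this, map_one])
  refine ⟨θ, ?_, hW⟩
  -- If `h` acts trivially, `j h` commutes with all left multiplications. They are transitive on the
  -- eight signed points and `j h` fixes the point 1, so `j h` fixes everything.
  rw [injective_iff_map_eq_one]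
  intro h hh
  apply hj
  rw [map_one]
  apply Subtype.ext
  apply toPerm_injective
  ext1 p
  obtain ⟨x, rfl⟩ := toPerm_quaternionHom_transitive p
  have h1 := hθ h x
  rw [hh, MulAut.one_apply, eq_mul_inv_iff_mul_eq] at h1
  have h2 : (j h).1 * quaternionHom x = quaternionHom x * (j h).1 :=
    (congrArg Subtype.val h1).symm
  rw [← Equiv.Perm.mul_apply, ← map_mul, h2, map_mul, Equiv.Perm.mul_apply, hjfix]
  simp

end SignedPerm

/-! ### Two cycles of coprime lengths -/

section CyclePair

/-- The permutation `j ↦ j + 1` on each of two cycles of lengths `a` and `b`. -/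
def twoCycles (a b : ℕ) : Equiv.Perm (ZMod a ⊕ ZMod b) :=
  Equiv.Perm.sumCongr (Equiv.addRight 1) (Equiv.addRight 1)

theorem twoCycles_pow_inl (a b n : ℕ) (j : ZMod a) :
    (twoCycles a b ^ n) (Sum.inl j) = Sum.inl (j + n) := by
  induction n with
  | zero => simp
  | succ n ih =>
    rw [pow_succ', Equiv.Perm.mul_apply, ih]
    simp [twoCycles, add_assoc]

theorem twoCycles_pow_inr (a b n : ℕ) (j : ZMod b) :
    (twoCycles a b ^ n) (Sum.inr j) = Sum.inr (j + n) := by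
  induction n with
  | zero => simp
  | succ n ih =>
    rw [pow_succ', Equiv.Perm.mul_apply, ih]
    simp [twoCycles, add_assoc]

theorem ZMod.sign_addRight_one (n : ℕ) [NeZero n] :
    Equiv.Perm.sign (Equiv.addRight (1 : ZMod n)) = (-1) ^ (n + 1) := by
  obtain ⟨k, rfl⟩ := Nat.exists_eq_succ_of_ne_zero (NeZero.ne n)
  have : (Equiv.addRight (1 : ZMod (k + 1))) = finRotate (k + 1) := by
    ext1 x
    exact (finRotate_apply x).symm
  have h : Equiv.Perm.sign (Equiv.addRight (1 : ZMod (k + 1))) =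
      Equiv.Perm.sign (finRotate (k + 1)) := by
    rw [this]; rfl
  refine h.trans ?_
  rw [sign_finRotate, pow_succ, pow_succ]
  simp

theorem sign_twoCycles (a b : ℕ) [NeZero a] [NeZero b] :
    Equiv.Perm.sign (twoCycles a b) = (-1) ^ (a + b) := by
  rw [twoCycles, Equiv.Perm.sign_sumCongr, ZMod.sign_addRight_one, ZMod.sign_addRight_one,
    pow_succ, pow_succ, pow_add]
  simp

theorem exists_twoCycles_pow {a b : ℕ} (h : a.Coprime b) [NeZero a] [NeZero b] (i : ZMod a)
    (j : ZMod b) : ∃ n : ℕ, (twoCycles a b ^ n) (Sum.inl 0) = Sum.inl i ∧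
      (twoCycles a b ^ n) (Sum.inr 0) = Sum.inr j := by
  obtain ⟨n, h1, h2⟩ := Nat.chineseRemainder h i.val j.val
  refine ⟨n, ?_, ?_⟩
  · rw [twoCycles_pow_inl, zero_add, (ZMod.natCast_eq_natCast_iff _ _ _).2 h1,
      ZMod.natCast_zmod_val]
  · rw [twoCycles_pow_inr, zero_add, (ZMod.natCast_eq_natCast_iff _ _ _).2 h2,
      ZMod.natCast_zmod_val]

/-- By the Chinese remainder theorem the conjugates include every transposition joining a point of
one cycle to a point of the other; the resulting complete bipartite graph is connected. -/
theorem isPretransitive_conj_twoCycles {a b : ℕ} (h : a.Coprime b) [NeZero a] [NeZero b]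
    {β : Type*} [DecidableEq β] (η : β ≃ ZMod a ⊕ ZMod b) :
    MulAction.IsPretransitive (Subgroup.closure (Set.range fun n : ℕ =>
      η.symm.permCongr (twoCycles a b) ^ n * Equiv.swap (η.symm (Sum.inl 0)) (η.symm (Sum.inr 0)) *
        (η.symm.permCongr (twoCycles a b) ^ n)⁻¹)) β := by
  set S := Subgroup.closure (Set.range fun n : ℕ =>
      η.symm.permCongr (twoCycles a b) ^ n * Equiv.swap (η.symm (Sum.inl 0)) (η.symm (Sum.inr 0)) *
        (η.symm.permCongr (twoCycles a b) ^ n)⁻¹)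
  have hpow : ∀ (n : ℕ) (p : ZMod a ⊕ ZMod b), (η.symm.permCongr (twoCycles a b) ^ n) (η.symm p) =
      η.symm ((twoCycles a b ^ n) p) := by
    intro n p
    have : η.symm.permCongr (twoCycles a b) ^ n = η.symm.permCongr (twoCycles a b ^ n) :=
      (map_pow η.symm.permCongrHom (twoCycles a b) n).symm
    rw [this]
    simp
  have hswap : ∀ i j, Equiv.swap (η.symm (Sum.inl i)) (η.symm (Sum.inr j)) ∈ S := by
    intro i j
    obtain ⟨n, h1, h2⟩ := exists_twoCycles_pow h i j
    refine Subgroup.subset_closure ⟨n, ?_⟩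
    rw [← h1, ← h2, ← hpow, ← hpow]
    exact (Equiv.swap_apply_apply _ _ _).symm
  rw [MulAction.isPretransitive_iff_base (η.symm (Sum.inl 0))]
  intro x
  obtain ⟨p, rfl⟩ := η.symm.surjective x
  rcases p with i | j
  · refine ⟨⟨_, S.mul_mem (hswap i 0) (hswap 0 0)⟩, ?_⟩
    change (Equiv.swap _ _ * Equiv.swap _ _ : Equiv.Perm β) _ = _
    rw [Equiv.Perm.mul_apply, Equiv.swap_apply_left, Equiv.swap_apply_right]
  · exact ⟨⟨_, hswap 0 j⟩, Equiv.swap_apply_left _ _⟩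

end CyclePair

/-! ### Walking around a black vertex -/

section Walk

theorem ZMod.val_add_one_eq_mod {n : ℕ} [NeZero n] (j : ZMod n) :
    (j + 1).val = (j.val + 1) % n := by
  conv_lhs => rw [← ZMod.natCast_zmod_val j, ← Nat.cast_one, ← Nat.cast_add, ZMod.val_natCast]

theorem Equiv.Perm.pow_apply_eq_of_modEq {E : Type*} (σ : Equiv.Perm E) {x : E} {n a b : ℕ}
    (hx : (σ ^ n) x = x) (h : a ≡ b [MOD n]) : (σ ^ a) x = (σ ^ b) x := by
  have hx' : Function.IsPeriodicPt σ n x := by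
    rwa [Function.IsPeriodicPt, Function.IsFixedPt, Equiv.Perm.iterate_eq_pow]
  rw [← Equiv.Perm.iterate_eq_pow, ← Equiv.Perm.iterate_eq_pow, ← hx'.iterate_mod_apply a,
    ← hx'.iterate_mod_apply b, h]

/-- Adding one to the exponent `i + d * j` modulo `n * d` carries into `j` exactly when `i` wraps to
0, which is the rule of a wrapped shift. -/
theorem Equiv.Perm.apply_pow_val_add {E : Type*} (σ : Equiv.Perm E) {d n : ℕ} [NeZero d] [NeZero n]
    {x : E} (hx : (σ ^ (n * d)) x = x) (i : ZMod d) (j : ZMod n) :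
    σ ((σ ^ (i.val + d * j.val)) x) =
      (σ ^ ((i + 1).val + d * (if i + 1 = 0 then j + 1 else j).val)) x := by
  rw [← Equiv.Perm.mul_apply, ← pow_succ']
  apply σ.pow_apply_eq_of_modEq hx
  have hi : i.val < d := ZMod.val_lt i
  split_ifs with h
  · have h0 : (i.val + 1) % d = 0 := by rw [← ZMod.val_add_one_eq_mod, h, ZMod.val_zero]
    have h1 : i.val + 1 = d := by
      have := Nat.le_of_dvd (by omega) (Nat.dvd_of_mod_eq_zero h0)
      omega
    rw [h, ZMod.val_zero, zero_add, ZMod.val_add_one_eq_mod, mul_comm n d]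
    have : i.val + d * j.val + 1 = d * (j.val + 1) := by rw [mul_add, mul_one]; omega
    rw [this]
    exact ((Nat.mod_modEq _ _).mul_left' d).symm
  · have h1 : (i + 1).val = i.val + 1 := by
      rw [ZMod.val_add_one_eq_mod]
      apply Nat.mod_eq_of_lt
      have h2 : i.val + 1 ≠ d := by
        intro hd
        apply h
        rw [← ZMod.natCast_zmod_val i]
        exact_mod_cast (by rw [hd]; exact ZMod.natCast_self d : ((i.val + 1 : ℕ) : ZMod d) = 0)
      omega
    rw [h1, add_right_comm]

end Walk

/-! ### Labelling the edges of the tree -/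

namespace BicolouredPlaneTree

variable {E : Type*} [Fintype E] [DecidableEq E]

/-- In a finite group the closure is already generated as a monoid, so stability under inverses need
not be checked. -/
theorem surjective_of_invariant (T : BicolouredPlaneTree E) {X : Type*} [Nonempty X] (F : X → E)
    (h0 : ∀ p, T.σ₀ (F p) ∈ Set.range F) (h1 : ∀ p, T.σ₁ (F p) ∈ Set.range F) :
    Function.Surjective F := by
  have key : ∀ g ∈ Subgroup.closure {T.σ₀, T.σ₁}, Set.MapsTo g (Set.range F) (Set.range F) := by
    intro g hg
    rw [← Subgroup.mem_toSubmonoid, Subgroup.closure_toSubmonoid_of_finite] at hg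
    induction hg using Submonoid.closure_induction with
    | mem g hg =>
      rcases hg with rfl | rfl
      · rintro _ ⟨p, rfl⟩; exact h0 p
      · rintro _ ⟨p, rfl⟩; exact h1 p
    | one => exact Set.mapsTo_id _
    | mul a b _ _ ha hb => exact ha.comp hb
  intro y
  obtain ⟨p⟩ := ‹Nonempty X›
  obtain ⟨g, hg, hy⟩ := T.connected (F p) y
  rw [← hy]
  exact key g hg ⟨p, rfl⟩

/-- When all white vertices but one have degree `1`, the edges at the other ones are fixed. -/
theorem σ₁_apply_eq_or (T : BicolouredPlaneTree E) {k : ℕ}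
    (h : T.σ₁.partition.parts = 4 ::ₘ Multiset.replicate k 1) {e : E}
    (he : Function.minimalPeriod T.σ₁ e = 4) (x : E) :
    T.σ₁ x = x ∨ ∃ n < 4, x = (T.σ₁ ^ n) e := by
  by_cases hx : T.σ₁ x = x
  · exact Or.inl hx
  right
  have hct : T.σ₁.cycleType = {4} := by
    rw [← Equiv.Perm.filter_parts_partition_eq_cycleType, h]
    rw [Multiset.filter_cons_of_pos _ (by norm_num), Multiset.filter_eq_nil.2]
    · rfl
    · intro a ha
      rw [Multiset.eq_of_mem_replicate ha]
      norm_num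
  have hcyc : T.σ₁.IsCycle := by
    rw [← Equiv.Perm.card_cycleType_eq_one, hct]; rfl
  have hee : T.σ₁ e ≠ e := by
    intro h
    have := (Function.IsPeriodicPt.minimalPeriod_dvd (n := 1) h)
    rw [he] at this
    norm_num at this
  obtain ⟨i, hi⟩ := hcyc.exists_pow_eq hee hx
  refine ⟨i % 4, Nat.mod_lt _ (by norm_num), ?_⟩
  rw [← hi, ← he, ← Equiv.Perm.iterate_eq_pow, ← Equiv.Perm.iterate_eq_pow,
    Function.iterate_mod_minimalPeriod_eq]

/-- The edges of `T_{2,1}` can be labelled by `ZMod d × (Fin m × ℤ/2)` so that the rotation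
at the black vertices is a wrapped shift and the rotation at the white vertices is a signed
transposition of the fibre over `0`. -/
theorem exists_labelling (T : BicolouredPlaneTree E) {r s d r₁ s₁ : ℕ} [NeZero d] [NeZero r₁]
    [NeZero s₁] (hT : T.IsT21 r s) (hr : r = r₁ * d) (hs : s = s₁ * d)
    (η : Fin (r₁ + s₁) ≃ ZMod r₁ ⊕ ZMod s₁) :
    ∃ φ : ZMod d × (Fin (r₁ + s₁) × CyclicGroup 2) ≃ E,
      φ.permCongr (wrapShift d (SignedPerm.toPerm _
        (SemidirectProduct.inr (η.symm.permCongr (twoCycles r₁ s₁))))) = T.σ₀ ∧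
      φ.permCongr (fiberPerm d _ (Pi.mulSingle 0 (SignedPerm.toPerm _
        (SignedPerm.signedSwap (η.symm (Sum.inl 0)) (η.symm (Sum.inr 0)))))) = T.σ₁ := by
  obtain ⟨⟨-, hβ, hcard⟩, e, he, h0, h1, h2, h3⟩ := hT
  set c := SignedPerm.toPerm _ (SemidirectProduct.inr (φ := coordAction (Fin (r₁ + s₁)))
    (η.symm.permCongr (twoCycles r₁ s₁))) with hc
  set q := SignedPerm.toPerm _
    (SignedPerm.signedSwap (η.symm (Sum.inl 0)) (η.symm (Sum.inr 0))) with hq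
  have hper : ∀ x n, T.blackDegree x = n → (T.σ₀ ^ n) x = x := fun x n hn => by
    rw [← hn, ← Equiv.Perm.iterate_eq_pow]; exact Function.iterate_minimalPeriod
  have he4 : (T.σ₁ ^ 4) e = e := by
    rw [← he, ← Equiv.Perm.iterate_eq_pow]; exact Function.iterate_minimalPeriod
  -- Around the white vertex of degree 4, `e` and `σ₁ e` start the cycles of lengths `r` and `s`
  -- with sign `1`; the opposite edges start those with sign `gen`.
  let A : ZMod d → ZMod r₁ ⊕ ZMod s₁ → CyclicGroup 2 → E := fun i p ε =>
    Sum.elim (fun j => (T.σ₀ ^ (i.val + d * j.val)) (if ε = 1 then e else T.σ₁ (T.σ₁ e)))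
      (fun j => (T.σ₀ ^ (i.val + d * j.val))
        (if ε = 1 then T.σ₁ e else T.σ₁ (T.σ₁ (T.σ₁ e)))) p
  let F : ZMod d × (Fin (r₁ + s₁) × CyclicGroup 2) → E := fun p => A p.1 (η p.2.1) p.2.2
  have hF0 : ∀ p, T.σ₀ (F p) = F (wrapShift d c p) := by
    rintro ⟨i, a, ε⟩
    obtain ⟨p, rfl⟩ := η.symm.surjective a
    rcases p with j | j
    · have := T.σ₀.apply_pow_val_add (d := d) (n := r₁)
        (x := if ε = 1 then e else T.σ₁ (T.σ₁ e))
        (by split_ifs <;> exact hper _ _ (by rw [← hr]; assumption)) i j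
      by_cases hi : i + 1 = 0 <;>
        simpa [F, A, wrapShift_apply, hc, twoCycles, hi] using this
    · have := T.σ₀.apply_pow_val_add (d := d) (n := s₁)
        (x := if ε = 1 then T.σ₁ e else T.σ₁ (T.σ₁ (T.σ₁ e)))
        (by split_ifs <;> exact hper _ _ (by rw [← hs]; assumption)) i j
      by_cases hi : i + 1 = 0 <;>
        simpa [F, A, wrapShift_apply, hc, twoCycles, hi] using this
  -- The labels of the four edges at that white vertex, in cyclic order.
  let b : ℕ → ZMod d × (Fin (r₁ + s₁) × CyclicGroup 2) := fun n =>
    (0, (q ^ n) (η.symm (Sum.inl 0), 1))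
  have hqv : q (η.symm (Sum.inl 0), 1) = (η.symm (Sum.inr 0), 1) ∧
      q (η.symm (Sum.inr 0), 1) = (η.symm (Sum.inl 0), CyclicGroup.gen) ∧
      q (η.symm (Sum.inl 0), CyclicGroup.gen) = (η.symm (Sum.inr 0), CyclicGroup.gen) ∧
      q (η.symm (Sum.inr 0), CyclicGroup.gen) = (η.symm (Sum.inl 0), 1) := by
    have : CyclicGroup.gen * CyclicGroup.gen = 1 := CyclicGroup.mul_self_two _
    simp [hq, SignedPerm.signedSwap, this]
  have hgen : CyclicGroup.gen ≠ 1 := by decide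
  have hb : ∀ n < 4, F (b n) = (T.σ₁ ^ n) e ∧ F (b (n + 1)) = (T.σ₁ ^ (n + 1)) e := by
    intro n hn
    have e0 : F (b 0) = e := by simp [F, A, b]
    have e1 : F (b 1) = T.σ₁ e := by simp [F, A, b, hqv]
    have e2 : F (b 2) = T.σ₁ (T.σ₁ e) := by
      simp [F, A, b, hqv, pow_succ, hgen]
    have e3 : F (b 3) = T.σ₁ (T.σ₁ (T.σ₁ e)) := by
      simp [F, A, b, hqv, pow_succ, hgen]
    have e4 : F (b 4) = e := by
      simp [F, A, b, hqv, pow_succ]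
    interval_cases n
    · exact ⟨e0, e1⟩
    · exact ⟨e1, e2⟩
    · exact ⟨e2, e3⟩
    · exact ⟨e3, e4.trans he4.symm⟩
  have hsurj : Function.Surjective F := by
    have : NeZero (r₁ + s₁) := ⟨by have := NeZero.ne r₁; omega⟩
    apply T.surjective_of_invariant F (fun p => ⟨_, (hF0 p).symm⟩)
    intro p
    rcases T.σ₁_apply_eq_or hβ he (F p) with h | ⟨n, hn, h⟩
    · exact ⟨p, h.symm⟩
    · refine ⟨b (n + 1), ?_⟩
      rw [(hb n hn).2, h, pow_succ', Equiv.Perm.mul_apply]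
  -- Both sides have `2 * r + 2 * s` elements, so surjectivity suffices.
  have hbij : Function.Bijective F := by
    rw [Fintype.bijective_iff_surjective_and_card]
    refine ⟨hsurj, ?_⟩
    rw [hcard, Fintype.card_prod, Fintype.card_prod, Fintype.card_fin, ZMod.card, hr, hs]
    have : Fintype.card (CyclicGroup 2) = 2 := rfl
    rw [this]
    ring
  have hF1 : ∀ p, T.σ₁ (F p) = F (fiberPerm d _ (Pi.mulSingle 0 q) p) := by
    intro p
    by_cases hp : ∃ n < 4, p = b n
    · obtain ⟨n, hn, rfl⟩ := hp
      have : fiberPerm d _ (Pi.mulSingle 0 q) (b n) = b (n + 1) := by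
        simp [b, pow_succ']
      rw [this, (hb n hn).1, (hb n hn).2, pow_succ', Equiv.Perm.mul_apply]
    · have hfix : fiberPerm d _ (Pi.mulSingle 0 q) p = p := by
        rcases p with ⟨i, a, ε⟩
        by_cases hi : i = 0
        · subst hi
          have hne : ∀ n < 4, (a, ε) ≠ (q ^ n) (η.symm (Sum.inl 0), 1) := fun n hn h =>
            hp ⟨n, hn, by simp only [b, ← h]⟩
          have n0 := hne 0 (by norm_num)
          have n1 := hne 1 (by norm_num)
          have n2 := hne 2 (by norm_num)
          have n3 := hne 3 (by norm_num)
          simp only [pow_succ, pow_zero, one_mul, Equiv.Perm.mul_apply, hqv,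
            Equiv.Perm.one_apply] at n0 n1 n2 n3
          have ha1 : a ≠ η.symm (Sum.inl 0) := by
            rintro rfl
            rcases CyclicGroup.eq_one_or_gen ε with rfl | rfl
            · exact n0 rfl
            · exact n2 rfl
          have ha2 : a ≠ η.symm (Sum.inr 0) := by
            rintro rfl
            rcases CyclicGroup.eq_one_or_gen ε with rfl | rfl
            · exact n1 rfl
            · exact n3 rfl
          simp [hq, SignedPerm.signedSwap, Equiv.swap_apply_of_ne_of_ne ha1 ha2,
            Pi.mulSingle_eq_of_ne ha1]
        · simp [hi]
      rw [hfix]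
      rcases T.σ₁_apply_eq_or hβ he (F p) with h | ⟨n, hn, h⟩
      · exact h
      · exact absurd ⟨n, hn, hbij.1 (h.trans (hb n hn).1.symm)⟩ hp
  refine ⟨Equiv.ofBijective F hbij, ?_, ?_⟩
  · ext1 x
    obtain ⟨p, rfl⟩ := (Equiv.ofBijective F hbij).surjective x
    rw [Equiv.permCongr_apply, Equiv.symm_apply_apply]
    exact (hF0 p).symm
  · ext1 x
    obtain ⟨p, rfl⟩ := (Equiv.ofBijective F hbij).surjective x
    rw [Equiv.permCongr_apply, Equiv.symm_apply_apply]
    exact (hF1 p).symm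

end BicolouredPlaneTree

/-! ### The monodromy group as a wreath product -/

namespace BicolouredPlaneTree

variable {E : Type*} [Fintype E] [DecidableEq E]

theorem monodromyGroup_mulEquiv_of_labelling (T : BicolouredPlaneTree E) {X : Type*} (φ : X ≃ E)
    {a b : Equiv.Perm X} (ha : φ.permCongr a = T.σ₀) (hb : φ.permCongr b = T.σ₁) :
    Nonempty (T.monodromyGroup ≃* Subgroup.closure {a, b}) := by
  have : T.monodromyGroup = (Subgroup.closure {a, b}).map φ.permCongrHom.toMonoidHom := by
    rw [MonoidHom.map_closure, Set.image_pair, monodromyGroup, ← ha, ← hb]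
    rfl
  rw [this]
  exact ⟨(φ.permCongrHom.subgroupMap _).symm⟩

theorem IsT21.pos {T : BicolouredPlaneTree E} {r s : ℕ} (hT : T.IsT21 r s) : 0 < r ∧ 0 < s := by
  have h := hT.1.1
  exact ⟨T.σ₀.partition.parts_pos (by rw [h]; simp), T.σ₀.partition.parts_pos (by rw [h]; simp)⟩

/-- The central element `ζ` corrects the determinant of the two-cycle permutation `c`, so that `c *
ζ⁻¹` is a rotation. It is `1` with `t = 1` for even dimension and `-1` with `t = 2` for odd
dimension. -/
theorem IsT21.nonempty_mulEquiv_cyclicWreath {T : BicolouredPlaneTree E} {r s d r₁ s₁ k t : ℕ}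
    (hT : T.IsT21 r s) (hd : d = Nat.gcd r s) (hr : r = r₁ * d) (hs : s = s₁ * d)
    (hk : k = t * d) (hdk : d ∣ k) (ht : 0 < t) (ζ : SignedPerm (Fin (r₁ + s₁)))
    (hζ : ∀ g, Commute ζ g) (hζt : ζ ^ t = 1)
    (hζm : SignedPerm.det _ ζ = (-1) ^ (r₁ + s₁))
    (hζdvd : ∀ j, ζ ^ j ∈ SignedPerm.rotation (Fin (r₁ + s₁)) → t ∣ j) :
    Nonempty (T.monodromyGroup ≃*
      CyclicWreath (SignedPerm.rotation (Fin (r₁ + s₁))) hdk) := by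
  obtain ⟨hr0, hs0⟩ := hT.pos
  have hd0 : 0 < d := hd ▸ Nat.gcd_pos_of_pos_left _ hr0
  have : NeZero d := ⟨hd0.ne'⟩
  have : NeZero r₁ := ⟨by rintro rfl; simp [hr] at hr0⟩
  have : NeZero s₁ := ⟨by rintro rfl; simp [hs] at hs0⟩
  have : NeZero k := ⟨by rw [hk]; exact (Nat.mul_pos ht hd0).ne'⟩
  have : NeZero (r₁ + s₁) := ⟨by have := NeZero.ne r₁; omega⟩
  have hcop : r₁.Coprime s₁ := by
    rw [hr, hs, Nat.gcd_mul_right] at hd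
    exact (Nat.mul_eq_right hd0.ne').1 hd.symm
  have hcard : Fintype.card (Fin (r₁ + s₁)) = Fintype.card (ZMod r₁ ⊕ ZMod s₁) := by
    simp [ZMod.card]
  let η := Fintype.equivOfCardEq hcard
  obtain ⟨φ, ha, hb⟩ := T.exists_labelling hT hr hs η
  obtain ⟨e₁⟩ := T.monodromyGroup_mulEquiv_of_labelling φ ha hb
  set c : SignedPerm (Fin (r₁ + s₁)) :=
    SemidirectProduct.inr (η.symm.permCongr (twoCycles r₁ s₁)) with hc
  have hne : η.symm (Sum.inl 0) ≠ η.symm (Sum.inr 0) := by simp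
  -- The cycles contribute `(-1) ^ (r₁ - 1)` and `(-1) ^ (s₁ - 1)`, whose product is `(-1) ^ (r₁ +
  -- s₁)`.
  have hdetc : SignedPerm.det _ c = (-1) ^ (r₁ + s₁) := by
    rw [SignedPerm.det_apply, hc, SemidirectProduct.right_inr, Equiv.Perm.sign_permCongr,
      sign_twoCycles]
    simp
  let ρ : SignedPerm.rotation (Fin (r₁ + s₁)) →* Equiv.Perm (Fin (r₁ + s₁) × CyclicGroup 2) :=
    (SignedPerm.toPerm _).comp (SignedPerm.rotation _).subtype
  let w : SignedPerm.rotation (Fin (r₁ + s₁)) :=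
    ⟨c * ζ⁻¹, by rw [MonoidHom.mem_ker, map_mul, map_inv, hdetc, hζm, mul_inv_cancel]⟩
  let q : SignedPerm.rotation (Fin (r₁ + s₁)) :=
    ⟨_, SignedPerm.signedSwap_mem_rotation hne⟩
  have hwz : ρ w * SignedPerm.toPerm _ ζ = SignedPerm.toPerm _ c := by
    change SignedPerm.toPerm _ (c * ζ⁻¹) * _ = _
    rw [← map_mul, inv_mul_cancel_right]
  obtain ⟨e₂⟩ := closure_wrapShift_mulEquiv hk hdk ρ
    (fun x y h => Subtype.ext (SignedPerm.toPerm_injective h)) (SignedPerm.toPerm _ ζ)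
    (by rw [← map_pow, hζt, map_one])
    (fun g => (hζ g.1).map (SignedPerm.toPerm _))
    (by
      rintro j ⟨g, hg⟩
      apply hζdvd
      rw [← map_pow] at hg
      rw [← SignedPerm.toPerm_injective hg]
      exact g.2)
    q w
    (by
      intro L hL
      have := SignedPerm.rotation_le_of_conj_signedSwap_mem c hne
        (isPretransitive_conj_twoCycles hcop η) (L.comap (SignedPerm.toPerm _)) (fun j => by
          have := hL j
          rw [hwz] at this
          rw [Subgroup.mem_comap, map_mul, map_mul, map_inv, map_pow]
          exact this)
      rintro _ ⟨g, rfl⟩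
      exact this g.2)
  rw [hwz] at e₂
  exact ⟨e₁.trans e₂⟩

theorem IsT21.nonempty_mulEquiv_of_even {T : BicolouredPlaneTree E} {r s d r₁ s₁ : ℕ}
    (hT : T.IsT21 r s) (hd : d = Nat.gcd r s) (hr : r = r₁ * d) (hs : s = s₁ * d)
    (hm : Even (r₁ + s₁)) : Nonempty (T.monodromyGroup ≃*
      CyclicWreath (SignedPerm.rotation (Fin (r₁ + s₁))) (dvd_refl d)) :=
  hT.nonempty_mulEquiv_cyclicWreath hd hr hs (one_mul d).symm _ one_pos 1 Commute.one_left
    (one_pow _) (by rw [map_one, hm.neg_one_pow]) (fun j _ => one_dvd j)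

theorem IsT21.nonempty_mulEquiv_of_odd {T : BicolouredPlaneTree E} {r s d r₁ s₁ : ℕ}
    (hT : T.IsT21 r s) (hd : d = Nat.gcd r s) (hr : r = r₁ * d) (hs : s = s₁ * d)
    (hm : Odd (r₁ + s₁)) : Nonempty (T.monodromyGroup ≃*
      CyclicWreath (SignedPerm.rotation (Fin (r₁ + s₁))) (Dvd.intro_left 2 rfl : d ∣ 2 * d)) := by
  have hdet : SignedPerm.det (Fin (r₁ + s₁))
      (SemidirectProduct.inl fun _ => CyclicGroup.gen) = -1 := by
    rw [SignedPerm.det_apply]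
    simp [CyclicGroup.toUnits_gen, hm.neg_one_pow]
  refine hT.nonempty_mulEquiv_cyclicWreath hd hr hs rfl _ two_pos
    (SemidirectProduct.inl fun _ => CyclicGroup.gen) ?_ ?_ ?_ ?_
  · intro g
    refine SemidirectProduct.ext ?_ ?_
    · funext i
      simp [mul_comm]
    · simp
  · rw [← map_pow, pow_two]
    have : ((fun _ => CyclicGroup.gen) * fun _ => CyclicGroup.gen :
      Fin (r₁ + s₁) → CyclicGroup 2) = 1 := funext fun _ => CyclicGroup.mul_self_two _
    rw [this, map_one]
  · rw [hdet, hm.neg_one_pow]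
  · intro j hj
    rw [MonoidHom.mem_ker, map_pow, hdet] at hj
    by_contra h
    rw [(Nat.not_even_iff_odd.1 fun he => h he.two_dvd).neg_one_pow] at hj
    exact absurd hj (by decide)

end BicolouredPlaneTree

theorem mainTheorem2 {E : Type*} [Fintype E] [DecidableEq E]
    (T : BicolouredPlaneTree E) (r s d r₁ s₁ : ℕ) (hrs : r ≠ s)
    (hT : T.IsT21 r s)
    (hd : d = Nat.gcd r s) (hr₁ : r = r₁ * d) (hs₁ : s = s₁ * d) :
    ((r₁, s₁) = (1, 2) →
      Nonempty (T.monodromyGroup ≃*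
        CyclicWreath (Equiv.Perm (Fin 4)) (Dvd.intro_left 2 rfl : d ∣ 2 * d))) ∧
    ((r₁, s₁) = (1, 3) →
      ∃ θ : Equiv.Perm (Fin 4) →* MulAut (QuaternionGroup 2), Function.Injective θ ∧
        Nonempty (T.monodromyGroup ≃*
          CyclicWreath (QuaternionGroup 2 ⋊[θ] Equiv.Perm (Fin 4)) (dvd_refl d))) ∧
    (Even (r₁ + s₁) → (r₁, s₁) ≠ (1, 3) →
      ∃ ψ : CyclicGroup 2 →*
          MulAut (EvenVec (r₁ + s₁) ⋊[altAction (r₁ + s₁)] alternatingGroup (Fin (r₁ + s₁))),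
        Nonempty (T.monodromyGroup ≃*
          CyclicWreath
            ((EvenVec (r₁ + s₁) ⋊[altAction (r₁ + s₁)] alternatingGroup (Fin (r₁ + s₁)))
              ⋊[ψ] CyclicGroup 2)
            (dvd_refl d))) ∧
    (Odd (r₁ + s₁) → (r₁, s₁) ≠ (1, 2) →
      Nonempty (T.monodromyGroup ≃*
        CyclicWreath
          (EvenVec (r₁ + s₁) ⋊[permAction (r₁ + s₁)] Equiv.Perm (Fin (r₁ + s₁)))
          (Dvd.intro_left 2 rfl : d ∣ 2 * d))) := by
  have hodd : Odd (r₁ + s₁) → _ := hT.nonempty_mulEquiv_of_odd hd hr₁ hs₁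
  have heven : Even (r₁ + s₁) → _ := hT.nonempty_mulEquiv_of_even hd hr₁ hs₁
  refine ⟨?_, ?_, ?_, ?_⟩
  · intro h
    obtain ⟨rfl, rfl⟩ := Prod.mk.inj h
    obtain ⟨e⟩ := hodd (by decide)
    obtain ⟨f⟩ := SignedPerm.rotation_three_mulEquiv
    exact ⟨e.trans (CyclicWreath.congr f _)⟩
  · intro h
    obtain ⟨rfl, rfl⟩ := Prod.mk.inj h
    obtain ⟨e⟩ := heven (by decide)
    obtain ⟨θ, hθ, ⟨f⟩⟩ := SignedPerm.exists_rotation_four_mulEquiv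
    exact ⟨θ, hθ, ⟨e.trans (CyclicWreath.congr f _)⟩⟩
  · intro hm _
    obtain ⟨hr0, hs0⟩ := hT.pos
    -- From `r ≠ s` the two cycle lengths are distinct and positive; the third coordinate is needed
    -- for the splitting involution.
    have h3 : 3 ≤ r₁ + s₁ := by
      have h1 : r₁ ≠ 0 := by rintro rfl; simp [hr₁] at hr0
      have h2 : s₁ ≠ 0 := by rintro rfl; simp [hs₁] at hs0
      have h4 : r₁ ≠ s₁ := by rintro rfl; exact hrs (hr₁.trans hs₁.symm)
      omega
    obtain ⟨e⟩ := heven hm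
    obtain ⟨ψ, ⟨f⟩⟩ := SignedPerm.exists_rotation_mulEquiv h3
    exact ⟨ψ, ⟨e.trans (CyclicWreath.congr f _)⟩⟩
  · intro hm _
    obtain ⟨e⟩ := hodd hm
    exact ⟨e.trans (CyclicWreath.congr (SignedPerm.rotationEquivOfOdd hm) _)⟩
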